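/- Let $M$ be an oriented smooth four-manifold with an anti-self-dual conformal structure, i.e. a conformal class $c$ of Riemannian metrics on $M$ whose Weyl tensor has vanishing self-dual part, $W^+=0$. Let $\mathbf g\in c$ be any representative metric, and suppose that on an open set $U\subseteq M$ it is written in the null-tetrad form $$\mathbf g=\boldsymbol\epsilon^1\otimes\boldsymbol\epsilon^2+\boldsymbol\epsilon^2\otimes\boldsymbol\epsilon^1+\boldsymbol\epsilon^3\otimes\boldsymbol\epsilon^4+\boldsymbol\epsilon^4\otimes\boldsymbol\epsilon^3,$$ where $\boldsymbol\epsilon^1,\dots,\boldsymbol\epsilon^4$ are smooth sections of $T^*M\otimes\mathbb C$ over $U$, ordered so that $\boldsymbol\epsilon^1\wedge\boldsymbol\epsilon^2\wedge\boldsymbol\epsilon^3\wedge\boldsymbol\epsilon^4$ is the oriented volume form of $\mathbf g$. Let $\mathbf e_1,\dots,\mathbf e_4$ be the dual complex vector fields on $U$, $\langle\boldsymbol\epsilon^i,\mathbf e_j\rangle=\delta^i_j$. Then there exist a smooth complex 1-form $\mathbf A=\mathbf A^{(0)}+\lambda\mathbf A^{(1)}+\lambda^2\mathbf A^{(2)}$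 on $U$, quadratic in the parameter $\lambda$ (an arbitrary affine coordinate value, $\lambda\in\mathbb C$, on $\mathbf P^1$), and two functions $\alpha=\alpha_0+\lambda\alpha_1+\lambda^2\alpha_2$, $\beta=\beta_0+\lambda\beta_1+\lambda^2\beta_2$, also quadratic in $\lambda$, with smooth complex-valued coefficients $\alpha_k,\beta_k$ on $U$, such that the differential operators $$D_i=\mathbf e_i+A_i\,\frac{\partial}{\partial\lambda},\qquad A_i=\langle\mathbf A,\mathbf e_i\rangle,\qquad i=1,\dots,4,$$ acting on smooth complex-valued functions of $(x,\lambda)\in U\times\mathbb C$ (with $\partial/\partial\lambda$ the holomorphic derivative), satisfy the Lax-pair relation $$[D_4+\lambda D_2,\;D_1-\lambda D_3]=\alpha\,(D_4+\lambda D_2)+\beta\,(D_1-\lambda D_3).$$ Here "quadratic" means polynomial of degree at most two in $\lambda$. -/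

import Mathlib

open scoped Manifold ContDiff Topology Bundle

noncomputable section

namespace AntiSelfDual

/-- The model space `ℝ⁴` of a four-manifold. -/
abbrev E4 : Type := EuclideanSpace ℝ (Fin 4)

section

variable {M : Type*} [TopologicalSpace M] [ChartedSpace E4 M] [IsManifold (𝓡 4) ∞ M]

/-! ### Orientations, Riemannian metrics and conformal structures -/

variable (M) in
/-- An orientation of a four-manifold: an orientation of every tangent space such that near every
point there is a smooth local frame which is positively oriented. -/
structure ManifoldOrientation where
  /-- The orientation of each tangent space. -/
  orient (x : M) : Orientation ℝ (TangentSpace (𝓡 4) x) (Fin 4)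
  exists_frame (x₀ : M) : ∃ (u : Set M) (s : Fin 4 → (x : M) → TangentSpace (𝓡 4) x)
    (hs : IsLocalFrameOn (𝓡 4) E4 ∞ s u), u ∈ 𝓝 x₀ ∧
      ∀ (x : M) (hx : x ∈ u), (hs.toBasisAt hx).orientation = orient x

variable (M) in
/-- Smooth Riemannian metrics on a four-manifold. -/
abbrev RMetric :=
  Bundle.ContMDiffRiemannianMetric (𝓡 4) ∞ E4 (fun x : M => TangentSpace (𝓡 4) x)

/-- `g'` is conformal to `g`: `g' = ρ g` with a smooth positive function `ρ`. -/
def IsConformalTo (g g' : RMetric M) : Prop :=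
  ∃ ρ : M → ℝ, ContMDiff (𝓡 4) 𝓘(ℝ, ℝ) ∞ ρ ∧ (∀ x, 0 < ρ x) ∧
    ∀ (x : M) (v w : TangentSpace (𝓡 4) x), g'.inner x v w = ρ x * g.inner x v w

variable (M) in
/-- A conformal structure: the set of all metrics conformal to some given metric. -/
structure ConformalStructure where
  /-- The representative metrics. -/
  reps : Set (RMetric M)
  nonempty : reps.Nonempty
  mem_iff : ∀ g ∈ reps, ∀ g', g' ∈ reps ↔ IsConformalTo g g'

/-! ### The Weyl tensor, in local coordinates

Around `p` we use the preferred chart `φ = extChartAt (𝓡 4) p` of `M` at `p`. -/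

/-- The coordinate vector field `∂ᵢ` of the chart at `p`, at the point with coordinates `y`. -/
def coordVec (p : M) (y : E4) (i : Fin 4) : TangentSpace (𝓡 4) ((extChartAt (𝓡 4) p).symm y) :=
  mfderiv 𝓘(ℝ, E4) (𝓡 4) (extChartAt (𝓡 4) p).symm y (EuclideanSpace.single i (1 : ℝ) : E4)

/-- The matrix `g_{ij} = g(∂ᵢ, ∂ⱼ)` of the metric, at the point with coordinates `y`. -/
def gram (g : RMetric M) (p : M) (y : E4) : Matrix (Fin 4) (Fin 4) ℝ :=
  Matrix.of fun i j =>
    g.inner ((extChartAt (𝓡 4) p).symm y) (coordVec p y i) (coordVec p y j)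

/-- The `k`-th partial derivative of a function on `ℝ⁴`. -/
def pd (k : Fin 4) (F : E4 → ℝ) (y : E4) : ℝ :=
  fderiv ℝ F y (EuclideanSpace.single k (1 : ℝ))

/-- The Christoffel symbols `Γᵏᵢⱼ` of the Levi-Civita connection, `∇_{∂ᵢ} ∂ⱼ = ∑ₖ Γᵏᵢⱼ ∂ₖ`. -/
def christoffel (g : RMetric M) (p : M) (k i j : Fin 4) (y : E4) : ℝ :=
  (1 / 2 : ℝ) * ∑ l, (gram g p y)⁻¹ k l *
    (pd i (fun z => gram g p z j l) y + pd j (fun z => gram g p z i l) y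
      - pd l (fun z => gram g p z i j) y)

/-- The components `Rˡ_{kij}` of the curvature, `R(∂ᵢ, ∂ⱼ) ∂ₖ = ∑ₗ Rˡ_{kij} ∂ₗ`, where
`R(X, Y) = [∇_X, ∇_Y] - ∇_{[X, Y]}`. -/
def riemannUp (g : RMetric M) (p : M) (l k i j : Fin 4) (y : E4) : ℝ :=
  pd i (christoffel g p l j k) y - pd j (christoffel g p l i k) y
    + ∑ m, (christoffel g p l i m y * christoffel g p m j k y
      - christoffel g p l j m y * christoffel g p m i k y)

/-- The components `R_{ijkl} = g(R(∂ᵢ, ∂ⱼ) ∂ₖ, ∂ₗ)`. -/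
def riemann (g : RMetric M) (p : M) (i j k l : Fin 4) (y : E4) : ℝ :=
  ∑ m, gram g p y l m * riemannUp g p m k i j y

/-- The Ricci tensor `Ric(∂ⱼ, ∂ₖ) = tr (X ↦ R(X, ∂ⱼ) ∂ₖ)`. -/
def ricci (g : RMetric M) (p : M) (j k : Fin 4) (y : E4) : ℝ :=
  ∑ i, riemannUp g p i k i j y

/-- The scalar curvature. -/
def scalar (g : RMetric M) (p : M) (y : E4) : ℝ :=
  ∑ j, ∑ k, (gram g p y)⁻¹ j k * ricci g p j k y

/-- The components `W_{ijkl}` of the Weyl tensor in dimension four: the totally trace-free part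
of `R_{ijkl}`. -/
def weylComp (g : RMetric M) (p : M) (i j k l : Fin 4) (y : E4) : ℝ :=
  riemann g p i j k l y
    - (1 / 2 : ℝ) * (gram g p y i l * ricci g p j k y - gram g p y i k * ricci g p j l y
      + gram g p y j k * ricci g p i l y - gram g p y j l * ricci g p i k y)
    + scalar g p y / 6 * (gram g p y i l * gram g p y j k - gram g p y i k * gram g p y j l)

/-- The coordinates of a tangent vector at `p` in the chart at `p`. -/
def coords (p : M) (v : TangentSpace (𝓡 4) p) : E4 :=
  mfderiv (𝓡 4) 𝓘(ℝ, E4) (extChartAt (𝓡 4) p) p v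

/-- The Weyl tensor `W(v₁, v₂, v₃, v₄)` at the point `p`. -/
def weyl (g : RMetric M) (p : M) (v₁ v₂ v₃ v₄ : TangentSpace (𝓡 4) p) : ℝ :=
  ∑ i, ∑ j, ∑ k, ∑ l, coords p v₁ i * coords p v₂ j * coords p v₃ k * coords p v₄ l *
    weylComp g p i j k l (extChartAt (𝓡 4) p p)

/-! ### Anti-self-duality -/

/-- `b` is a positively oriented orthonormal basis of the tangent space at `x`. -/
def IsOrientedOrthonormal (o : ManifoldOrientation M) (g : RMetric M) (x : M)
    (b : Module.Basis (Fin 4) ℝ (TangentSpace (𝓡 4) x)) : Prop :=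
  b.orientation = o.orient x ∧ ∀ i j, g.inner x (b i) (b j) = if i = j then 1 else 0

/-- `W⁺ = 0`: the Weyl tensor, as an operator on bivectors, annihilates the self-dual bivectors.
The latter are spanned by the `b₀ ∧ b₁ + b₂ ∧ b₃ = b₀ ∧ b₁ + ⋆(b₀ ∧ b₁)`, where `b` runs through
the positively oriented orthonormal bases. -/
def WeylPlusVanishes (o : ManifoldOrientation M) (g : RMetric M) : Prop :=
  ∀ (x : M) (b : Module.Basis (Fin 4) ℝ (TangentSpace (𝓡 4) x)), IsOrientedOrthonormal o g x b →
    ∀ v w : TangentSpace (𝓡 4) x, weyl g x (b 0) (b 1) v w + weyl g x (b 2) (b 3) v w = 0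

/-- A conformal structure is anti-self-dual if a representative metric has `W⁺ = 0`
(this does not depend on the representative). -/
def ConformalStructure.IsAntiSelfDual (o : ManifoldOrientation M) (c : ConformalStructure M) :
    Prop :=
  ∃ g ∈ c.reps, WeylPlusVanishes o g

/-! ### Complex 1-forms, complex vector fields and null tetrads -/

variable (M) in
/-- Complex 1-forms, that is sections of `T*M ⊗ ℂ = Hom_ℝ(TM, ℂ)`. -/
abbrev CForm := (x : M) → (TangentSpace (𝓡 4) x →L[ℝ] ℂ)

/-- A complex 1-form is smooth on `U`. -/
def CForm.SmoothOn (ξ : CForm M) (U : Set M) : Prop :=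
  ContMDiffOn (𝓡 4) ((𝓡 4).prod 𝓘(ℝ, E4 →L[ℝ] ℂ)) ∞
    (fun x => Bundle.TotalSpace.mk' (E4 →L[ℝ] ℂ)
      (E := fun x : M => (TangentSpace (𝓡 4) x →L[ℝ] Bundle.Trivial M ℂ x)) x (ξ x)) U

variable (M) in
/-- Complex vector fields `re + i im`, that is sections of `TM ⊗ ℂ = TM ⊕ i TM`. -/
structure CVec where
  /-- The real part. -/
  re : (x : M) → TangentSpace (𝓡 4) x
  /-- The imaginary part. -/
  im : (x : M) → TangentSpace (𝓡 4) x

/-- A complex vector field is smooth on `U`. -/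
def CVec.SmoothOn (X : CVec M) (U : Set M) : Prop :=
  ContMDiffOn (𝓡 4) (𝓡 4).tangent ∞ (fun x => (⟨x, X.re x⟩ : TangentBundle (𝓡 4) M)) U ∧
  ContMDiffOn (𝓡 4) (𝓡 4).tangent ∞ (fun x => (⟨x, X.im x⟩ : TangentBundle (𝓡 4) M)) U

/-- The complex-linear pairing `⟨ξ, X⟩` at the point `x`. -/
def pair (x : M) (ξ : TangentSpace (𝓡 4) x →L[ℝ] ℂ) (X : CVec M) : ℂ :=
  ξ (X.re x) + Complex.I * ξ (X.im x)

/-- A null tetrad on `U` for the oriented Riemannian metric `g`: smooth complex 1-forms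
`ε⁰, ε¹, ε², ε³` with
`g = ε⁰ ⊗ ε¹ + ε¹ ⊗ ε⁰ + ε² ⊗ ε³ + ε³ ⊗ ε²` such that `ε⁰ ∧ ε¹ ∧ ε² ∧ ε³` is the volume form of
`g`, together with the dual complex vector fields `e₀, e₁, e₂, e₃`. -/
structure IsNullTetrad (o : ManifoldOrientation M) (g : RMetric M) (U : Set M)
    (ε : Fin 4 → CForm M) (e : Fin 4 → CVec M) : Prop where
  smooth_form : ∀ i, (ε i).SmoothOn U
  smooth_vec : ∀ i, (e i).SmoothOn U
  metric_eq : ∀ x ∈ U, ∀ v w : TangentSpace (𝓡 4) x,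
    ((g.inner x v w : ℝ) : ℂ) =
      ε 0 x v * ε 1 x w + ε 1 x v * ε 0 x w + ε 2 x v * ε 3 x w + ε 3 x v * ε 2 x w
  volume_eq : ∀ x ∈ U, ∀ b : Module.Basis (Fin 4) ℝ (TangentSpace (𝓡 4) x),
    IsOrientedOrthonormal o g x b → (Matrix.of fun i j => ε i x (b j)).det = 1
  dual : ∀ x ∈ U, ∀ i j, pair x (ε i x) (e j) = if i = j then 1 else 0

/-! ### The differential operators -/

/-- The action of a complex vector field on `M` on a function of `(x, λ)`. -/
def CVec.act (X : CVec M) (f : M × ℂ → ℂ) (q : M × ℂ) : ℂ :=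
  pair q.1 (mvfderiv (𝓡 4) (fun y => f (y, q.2)) q.1) X

/-- The holomorphic derivative `∂/∂λ = (∂/∂s - i ∂/∂t) / 2`, where `λ = s + i t`. -/
def dLam (f : M × ℂ → ℂ) (q : M × ℂ) : ℂ :=
  (fderiv ℝ (fun z => f (q.1, z)) q.2 1 - Complex.I * fderiv ℝ (fun z => f (q.1, z)) q.2 Complex.I)
    / 2

/-- The 1-form `A = A⁰ + λ A¹ + λ² A²` with coefficients `A⁰, A¹, A²`. -/
def quadForm (A : Fin 3 → CForm M) (z : ℂ) : CForm M :=
  fun x => A 0 x + z • A 1 x + z ^ 2 • A 2 x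

/-- The function `α⁰ + λ α¹ + λ² α²` of `(x, λ)` with coefficients `α⁰, α¹, α²`. -/
def quadFun (α : Fin 3 → M → ℂ) (q : M × ℂ) : ℂ :=
  α 0 q.1 + q.2 * α 1 q.1 + q.2 ^ 2 * α 2 q.1

/-- The operators `Dᵢ = eᵢ + Aᵢ ∂/∂λ`, where `Aᵢ = ⟨A, eᵢ⟩`. -/
def opD (e : Fin 4 → CVec M) (A : Fin 3 → CForm M) (i : Fin 4) (f : M × ℂ → ℂ) (q : M × ℂ) : ℂ :=
  (e i).act f q + pair q.1 (quadForm A q.2 q.1) (e i) * dLam f q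

/-- The operator `D₄ + λ D₂` (with the indices `1, 2, 3, 4` written as `0, 1, 2, 3`). -/
def lax₁ (e : Fin 4 → CVec M) (A : Fin 3 → CForm M) (f : M × ℂ → ℂ) (q : M × ℂ) : ℂ :=
  opD e A 3 f q + q.2 * opD e A 1 f q

/-- The operator `D₁ - λ D₃` (with the indices `1, 2, 3, 4` written as `0, 1, 2, 3`). -/
def lax₂ (e : Fin 4 → CVec M) (A : Fin 3 → CForm M) (f : M × ℂ → ℂ) (q : M × ℂ) : ℂ :=
  opD e A 0 f q - q.2 * opD e A 2 f q

end

end AntiSelfDual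

end

open AntiSelfDual

/-! Write `V = e₃ + λ e₁` and `W = e₀ - λ e₂`, so that the two operators are the lifts of `V` and `W`
by the horizontal distribution `δ_X = X + ⟨A, X⟩ ∂/∂λ` on `M × ℂ`. For every `λ` the vectors `V, W`
span a totally null plane whose bivector `V ∧ W` is self-dual.

Let first `g` itself have `W⁺ = 0`, with Levi-Civita connection `∇`, and put
`⟨A, X⟩ = -g(∇_X V, W)`, where `λ` is held constant in `V`. This is quadratic in `λ`, and because
the plane of `V, W` is its own orthogonal complement it is the choice for which
`∇_X V + ⟨A, X⟩ ∂V/∂λ` and `∇_X W + ⟨A, X⟩ ∂W/∂λ` are again combinations of `V` and `W`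
(`IsNullFrame.covariant_vec`). Torsion-freeness then shows that the horizontal part of the
commutator of the two lifts is a combination of `V` and `W`
(`IsNullFrame.horizontal_commutator`). The vertical part is the curvature `dA + A ∧ ∂A/∂λ` evaluated
on `V, W`, which is `-g(R(V, W) V, W)` (`IsNullFrame.twistor_curvature`). In this number the Ricci
terms drop out since the plane is totally null, and the Weyl term since `V ∧ W` is self-dual and
`W⁺ = 0` (`WeylPlusVanishes.sum_riemann`).

If only a conformal metric `g' = s⁻² g` has `W⁺ = 0`, the form `A` is taken from the rescaled tetrad
`s⁻¹ εᵃ`, `s eₐ` of `g'`. The operators for `eₐ` are multiples of those for `s eₐ` by a function of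
`x`, so that their commutator is still a combination of the two (`IsNullFrame.lax_commutator`). The
coefficients `α, β` are read off by pairing with `ε³` and `ε⁰`, which annihilate the derivatives
`e₁ = ∂V/∂λ` and `-e₂ = ∂W/∂λ`: they are the components of `[V, W]` (with constant `λ`) along `e₃`
and `e₀`, hence quadratic in `λ`.

The computation takes place in a chart, with the tetrad written as a complex matrix `E` of
coordinates and its inverse `Θ`. By contrast, `A`, `α` and `β` are defined globally, through the
pairings of the forms `εᶜ` with the Lie brackets `[eₐ, e_b]`; the Koszul formula
(`IsNullFrame.sum_twistorCoeff`) identifies `A` with the expression by the connection matrices. -/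

noncomputable section

namespace AntiSelfDual

/-! ### Derivatives in complex directions and commutators -/

section ComplexDirections

variable {X : Type*} [NormedAddCommGroup X] [NormedSpace ℝ X]

/-- The derivative of `F` at `q` in the complex direction `u + i v`. -/
def cdir (u v : X) (F : X → ℂ) (q : X) : ℂ :=
  fderiv ℝ F q u + Complex.I * fderiv ℝ F q v

lemma cdir_const (u v : X) (c : ℂ) (q : X) : cdir u v (fun _ => c) q = 0 := by
  simp [cdir]

lemma cdir_add {u v : X} {F G : X → ℂ} {q : X} (hF : DifferentiableAt ℝ F q)
    (hG : DifferentiableAt ℝ G q) :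
    cdir u v (fun y => F y + G y) q = cdir u v F q + cdir u v G q := by
  simp only [cdir, fderiv_fun_add hF hG, add_apply]
  ring

lemma cdir_sub {u v : X} {F G : X → ℂ} {q : X} (hF : DifferentiableAt ℝ F q)
    (hG : DifferentiableAt ℝ G q) :
    cdir u v (fun y => F y - G y) q = cdir u v F q - cdir u v G q := by
  simp only [cdir, fderiv_fun_sub hF hG, sub_apply]
  ring

lemma cdir_mul {u v : X} {F G : X → ℂ} {q : X} (hF : DifferentiableAt ℝ F q)
    (hG : DifferentiableAt ℝ G q) :
    cdir u v (fun y => F y * G y) q = F q * cdir u v G q + cdir u v F q * G q := by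
  simp only [cdir, fderiv_fun_mul hF hG, add_apply,
    smul_apply, smul_eq_mul]
  ring

lemma cdir_sum {ι : Type*} {s : Finset ι} {u v : X} {F : ι → X → ℂ} {q : X}
    (hF : ∀ i ∈ s, DifferentiableAt ℝ (F i) q) :
    cdir u v (fun y => ∑ i ∈ s, F i y) q = ∑ i ∈ s, cdir u v (F i) q := by
  simp only [cdir, fderiv_fun_sum hF, sum_apply, Finset.mul_sum,
    Finset.sum_add_distrib]

lemma cdir_congr {u v : X} {F G : X → ℂ} {q : X} (h : F =ᶠ[𝓝 q] G) :
    cdir u v F q = cdir u v G q := by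
  simp only [cdir, h.fderiv_eq]

lemma cdir_contDiffAt (u v : X) {F : X → ℂ} {q : X} (hF : ContDiffAt ℝ ∞ F q) :
    ContDiffAt ℝ ∞ (cdir u v F) q := by
  have h : ContDiffAt ℝ ∞ (fderiv ℝ F) q := hF.fderiv_right (by simp)
  exact (h.clm_apply contDiffAt_const).add (contDiffAt_const.mul (h.clm_apply contDiffAt_const))

lemma cdir_comm (u v u' v' : X) {F : X → ℂ} {q : X} (hF : ContDiffAt ℝ ∞ F q) :
    cdir u v (cdir u' v' F) q = cdir u' v' (cdir u v F) q := by
  have hd : DifferentiableAt ℝ (fderiv ℝ F) q :=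
    (hF.fderiv_right (m := 1) (by norm_cast)).differentiableAt (by simp)
  have hs : IsSymmSndFDerivAt ℝ F q :=
    hF.isSymmSndFDerivAt (by simpa using ENat.LEInfty.out)
  have key : ∀ a b c d : X, cdir a b (cdir c d F) q =
      fderiv ℝ (fderiv ℝ F) q a c + Complex.I * fderiv ℝ (fderiv ℝ F) q a d
        + Complex.I * (fderiv ℝ (fderiv ℝ F) q b c
          + Complex.I * fderiv ℝ (fderiv ℝ F) q b d) := by
    intro a b c d
    have h1 : ∀ w : X, HasFDerivAt (fun y => fderiv ℝ F y w)
        ((ContinuousLinearMap.apply ℝ ℂ w).comp (fderiv ℝ (fderiv ℝ F) q)) q := fun w =>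
      (ContinuousLinearMap.apply ℝ ℂ w).hasFDerivAt.comp q hd.hasFDerivAt
    have h2 := (h1 c).add ((h1 d).const_mul Complex.I)
    have h3 : fderiv ℝ (cdir c d F) q = _ := h2.fderiv
    simp only [cdir] at h3 ⊢
    rw [h3]
    simp
  rw [key, key, hs.eq u u', hs.eq u v', hs.eq v u', hs.eq v v']
  ring

/-- The commutator of two first-order operators `∑ Yₘ ∂ₘ`, `∑ Zₘ ∂ₘ`, where `∂ₘ` are derivatives
in constant complex directions, is again of first order. -/
lemma cdir_commutator {ι : Type*} [Fintype ι] (u v : ι → X) {Y Z : ι → X → ℂ} {F : X → ℂ} {q : X}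
    (hY : ∀ m, DifferentiableAt ℝ (Y m) q) (hZ : ∀ m, DifferentiableAt ℝ (Z m) q)
    (hF : ContDiffAt ℝ ∞ F q) :
    (∑ m, Y m q * cdir (u m) (v m) (fun y => ∑ n, Z n y * cdir (u n) (v n) F y) q)
      - ∑ m, Z m q * cdir (u m) (v m) (fun y => ∑ n, Y n y * cdir (u n) (v n) F y) q
      = ∑ n, (∑ m, (Y m q * cdir (u m) (v m) (Z n) q - Z m q * cdir (u m) (v m) (Y n) q))
        * cdir (u n) (v n) F q := by
  have hd : ∀ n, DifferentiableAt ℝ (cdir (u n) (v n) F) q := fun n =>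
    (cdir_contDiffAt _ _ hF).differentiableAt (by simp)
  have expand : ∀ W : ι → X → ℂ, (∀ m, DifferentiableAt ℝ (W m) q) → ∀ m,
      cdir (u m) (v m) (fun y => ∑ n, W n y * cdir (u n) (v n) F y) q
        = ∑ n, (W n q * cdir (u m) (v m) (cdir (u n) (v n) F) q
          + cdir (u m) (v m) (W n) q * cdir (u n) (v n) F q) := by
    intro W hW m
    rw [cdir_sum (fun n _ => (hW n).fun_mul (hd n))]
    exact Finset.sum_congr rfl fun n _ => cdir_mul (hW n) (hd n)
  simp only [expand Z hZ, expand Y hY, Finset.mul_sum, mul_add, Finset.sum_add_distrib,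
    Finset.sum_mul, sub_mul, Finset.sum_sub_distrib]
  have h1 : ∑ m, ∑ n, Y m q * (Z n q * cdir (u m) (v m) (cdir (u n) (v n) F) q)
      = ∑ m, ∑ n, Z m q * (Y n q * cdir (u m) (v m) (cdir (u n) (v n) F) q) := by
    rw [Finset.sum_comm]
    refine Finset.sum_congr rfl fun m _ => Finset.sum_congr rfl fun n _ => ?_
    rw [cdir_comm _ _ _ _ hF]
    ring
  have h2 : ∀ A B : ι → X → ℂ,
      ∑ m, ∑ n, A m q * (cdir (u m) (v m) (B n) q * cdir (u n) (v n) F q)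
      = ∑ n, ∑ m, A m q * cdir (u m) (v m) (B n) q * cdir (u n) (v n) F q := by
    intro A B
    rw [Finset.sum_comm]
    exact Finset.sum_congr rfl fun m _ => Finset.sum_congr rfl fun n _ => by ring
  rw [h1, h2, h2]
  ring

end ComplexDirections

/-! ### Lifted operators on `ℝ⁴ × ℂ` -/

/-- The partial derivative `∂ₖ` of a complex-valued function on `ℝ⁴`. -/
def pdc (k : Fin 4) : (E4 → ℂ) → E4 → ℂ :=
  cdir (EuclideanSpace.single k (1 : ℝ)) 0

/-- The partial derivative `∂ₖ` of a complex-valued function on `ℝ⁴ × ℂ`. -/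
def pdX (k : Fin 4) : (E4 × ℂ → ℂ) → E4 × ℂ → ℂ :=
  cdir (EuclideanSpace.single k (1 : ℝ), 0) 0

/-- The holomorphic derivative `∂/∂λ` of a complex-valued function on `ℝ⁴ × ℂ`. -/
def pdZ : (E4 × ℂ → ℂ) → E4 × ℂ → ℂ :=
  cdir (0, 1 / 2) (0, -(Complex.I / 2))

lemma pdc_apply (k : Fin 4) (h : E4 → ℂ) (y : E4) :
    pdc k h y = fderiv ℝ h y (EuclideanSpace.single k (1 : ℝ)) := by
  simp [pdc, cdir]

lemma pdc_neg (k : Fin 4) (f : E4 → ℂ) (y : E4) : pdc k (fun y => -f y) y = -pdc k f y := by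
  simp [pdc_apply, fderiv_fun_neg]

lemma pdX_apply (k : Fin 4) (F : E4 × ℂ → ℂ) (q : E4 × ℂ) :
    pdX k F q = fderiv ℝ F q (EuclideanSpace.single k (1 : ℝ), 0) := by
  simp [pdX, cdir]

/-- The lifted operator `∑ᵢ Vᵢ (∂ᵢ + Aᵢ ∂/∂λ)` on functions on `ℝ⁴ × ℂ`. -/
def liftOp (V A : Fin 4 → E4 × ℂ → ℂ) (F : E4 × ℂ → ℂ) (q : E4 × ℂ) : ℂ :=
  ∑ i, V i q * (pdX i F q + A i q * pdZ F q)

/-- The components of the lifted operator `∑ᵢ Vᵢ (∂ᵢ + Aᵢ ∂/∂λ)` with respect to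
`∂/∂λ` (index `none`) and `∂ᵢ` (index `some i`). -/
def liftComp (V A : Fin 4 → E4 × ℂ → ℂ) : Option (Fin 4) → E4 × ℂ → ℂ
  | none => fun q => ∑ i, V i q * A i q
  | some i => V i

/-- The real parts of the directions of `∂/∂λ` and `∂ᵢ`. -/
def dirRe : Option (Fin 4) → E4 × ℂ
  | none => (0, 1 / 2)
  | some k => (EuclideanSpace.single k (1 : ℝ), 0)

/-- The imaginary parts of the directions of `∂/∂λ` and `∂ᵢ`. -/
def dirIm : Option (Fin 4) → E4 × ℂ
  | none => (0, -(Complex.I / 2))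
  | some _ => 0

lemma liftOp_eq_sum (V A : Fin 4 → E4 × ℂ → ℂ) (F : E4 × ℂ → ℂ) (q : E4 × ℂ) :
    liftOp V A F q = ∑ m, liftComp V A m q * cdir (dirRe m) (dirIm m) F q := by
  simp only [liftOp, Fintype.sum_option, liftComp, dirRe, dirIm, pdX, pdZ, mul_add,
    Finset.sum_add_distrib, Finset.sum_mul, mul_assoc]
  exact add_comm _ _

/-- The commutator of the lifts of `V` and `W` is a combination of these lifts as soon as the
horizontal commutator is a combination of `V` and `W`, and the curvature of `A` vanishes
on `V, W`. -/
lemma liftOp_commutator {V W A : Fin 4 → E4 × ℂ → ℂ} {F : E4 × ℂ → ℂ} {q : E4 × ℂ} {α β : ℂ}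
    (hV : ∀ i, DifferentiableAt ℝ (V i) q) (hW : ∀ i, DifferentiableAt ℝ (W i) q)
    (hA : ∀ i, DifferentiableAt ℝ (A i) q) (hF : ContDiffAt ℝ ∞ F q)
    (hT : ∀ j, liftOp V A (W j) q - liftOp W A (V j) q = α * V j q + β * W j q)
    (hcurv : ∑ i, ∑ j, V i q * W j q * (pdX i (A j) q + A i q * pdZ (A j) q
      - (pdX j (A i) q + A j q * pdZ (A i) q)) = 0) :
    liftOp V A (liftOp W A F) q - liftOp W A (liftOp V A F) q
      = α * liftOp V A F q + β * liftOp W A F q := by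
  have hcomp : ∀ {V : Fin 4 → E4 × ℂ → ℂ}, (∀ i, DifferentiableAt ℝ (V i) q) →
      ∀ m, DifferentiableAt ℝ (liftComp V A m) q := by
    intro V hV m
    cases m with
    | none => exact DifferentiableAt.fun_sum fun i _ => (hV i).fun_mul (hA i)
    | some i => exact hV i
  have hfun : ∀ V : Fin 4 → E4 × ℂ → ℂ, liftOp V A F =
      fun y => ∑ n, liftComp V A n y * cdir (dirRe n) (dirIm n) F y := fun V =>
    funext fun y => liftOp_eq_sum V A F y
  -- the horizontal derivation `δᵢ = ∂ᵢ + Aᵢ ∂/∂λ` of a pairing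
  have hpair : ∀ {V W : Fin 4 → E4 × ℂ → ℂ}, (∀ i, DifferentiableAt ℝ (V i) q) →
      (∀ i, DifferentiableAt ℝ (W i) q) →
      liftOp V A (liftComp W A none) q = ∑ j, (liftOp V A (W j) q * A j q)
        + ∑ i, ∑ j, V i q * W j q * (pdX i (A j) q + A i q * pdZ (A j) q) := by
    intro V W hV hW
    have e1 : ∀ i, pdX i (liftComp W A none) q =
        ∑ j, (W j q * pdX i (A j) q + pdX i (W j) q * A j q) := fun i => by
      simp only [pdX, liftComp]
      rw [cdir_sum fun j _ => (hW j).fun_mul (hA j)]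
      exact Finset.sum_congr rfl fun j _ => cdir_mul (hW j) (hA j)
    have e2 : pdZ (liftComp W A none) q =
        ∑ j, (W j q * pdZ (A j) q + pdZ (W j) q * A j q) := by
      simp only [pdZ, liftComp]
      rw [cdir_sum fun j _ => (hW j).fun_mul (hA j)]
      exact Finset.sum_congr rfl fun j _ => cdir_mul (hW j) (hA j)
    simp only [liftOp, e1, e2]
    simp only [Finset.sum_mul]
    rw [Finset.sum_comm (s := Finset.univ) (t := Finset.univ)
      (f := fun j i => V i q * (pdX i (W j) q + A i q * pdZ (W j) q) * A j q),
      ← Finset.sum_add_distrib]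
    refine Finset.sum_congr rfl fun i _ => ?_
    rw [Finset.mul_sum, ← Finset.sum_add_distrib, ← Finset.sum_add_distrib, Finset.mul_sum]
    exact Finset.sum_congr rfl fun j _ => by ring
  rw [hfun W, hfun V]
  rw [liftOp_eq_sum, liftOp_eq_sum, cdir_commutator dirRe dirIm (hcomp hV) (hcomp hW) hF]
  simp only [Finset.sum_sub_distrib, ← liftOp_eq_sum]
  have hnone : liftOp V A (liftComp W A none) q - liftOp W A (liftComp V A none) q
      = α * liftComp V A none q + β * liftComp W A none q := by
    rw [hpair hV hW, hpair hW hV]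
    have h1 : ∑ j, (liftOp V A (W j) q * A j q) - ∑ j, (liftOp W A (V j) q * A j q)
        = α * liftComp V A none q + β * liftComp W A none q := by
      simp only [liftComp, Finset.mul_sum]
      rw [← Finset.sum_sub_distrib, ← Finset.sum_add_distrib]
      refine Finset.sum_congr rfl fun j _ => ?_
      rw [← sub_mul, hT j]
      ring
    have h2 : ∑ i, ∑ j, V i q * W j q * (pdX i (A j) q + A i q * pdZ (A j) q)
        - ∑ i, ∑ j, W i q * V j q * (pdX i (A j) q + A i q * pdZ (A j) q) = 0 := by
      rw [Finset.sum_comm (s := Finset.univ) (t := Finset.univ)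
        (f := fun i j => W i q * V j q * (pdX i (A j) q + A i q * pdZ (A j) q)),
        ← Finset.sum_sub_distrib, ← hcurv]
      refine Finset.sum_congr rfl fun i _ => ?_
      rw [← Finset.sum_sub_distrib]
      exact Finset.sum_congr rfl fun j _ => by ring
    linear_combination h1 + h2
  have hall : ∀ m, liftOp V A (liftComp W A m) q - liftOp W A (liftComp V A m) q
      = α * liftComp V A m q + β * liftComp W A m q := by
    intro m
    cases m with
    | none => exact hnone
    | some j => exact hT j
  simp only [hall]
  rw [liftOp_eq_sum, liftOp_eq_sum, Finset.mul_sum, Finset.mul_sum, ← Finset.sum_add_distrib]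
  exact Finset.sum_congr rfl fun m _ => by ring

lemma pdX_fst (k : Fin 4) {h : E4 → ℂ} {q : E4 × ℂ} (hh : DifferentiableAt ℝ h q.1) :
    pdX k (fun q => h q.1) q = pdc k h q.1 := by
  have : HasFDerivAt (fun q : E4 × ℂ => h q.1) _ q := hh.hasFDerivAt.comp q hasFDerivAt_fst
  rw [pdX_apply, pdc_apply, this.fderiv]
  simp

lemma pdZ_fst {h : E4 → ℂ} {q : E4 × ℂ} (hh : DifferentiableAt ℝ h q.1) :
    pdZ (fun q => h q.1) q = 0 := by
  have : HasFDerivAt (fun q : E4 × ℂ => h q.1) _ q := hh.hasFDerivAt.comp q hasFDerivAt_fst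
  rw [pdZ, cdir, this.fderiv]
  simp

lemma pdX_snd (k : Fin 4) (q : E4 × ℂ) : pdX k (fun q => q.2) q = 0 := by
  rw [pdX_apply, (hasFDerivAt_snd (𝕜 := ℝ) (p := q)).fderiv]
  simp

lemma pdZ_snd (q : E4 × ℂ) : pdZ (fun q => q.2) q = 1 := by
  rw [pdZ, cdir, (hasFDerivAt_snd (𝕜 := ℝ) (p := q)).fderiv]
  simp only [ContinuousLinearMap.coe_snd']
  linear_combination (-1 / 2 : ℂ) * Complex.I_mul_I

/-- The derivatives of a function which is quadratic in `λ`. -/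
lemma pd_quadratic {a b c : E4 → ℂ} {q : E4 × ℂ} (ha : DifferentiableAt ℝ a q.1)
    (hb : DifferentiableAt ℝ b q.1) (hc : DifferentiableAt ℝ c q.1) :
    DifferentiableAt ℝ (fun q : E4 × ℂ => a q.1 + q.2 * b q.1 + q.2 ^ 2 * c q.1) q ∧
    (∀ k, pdX k (fun q => a q.1 + q.2 * b q.1 + q.2 ^ 2 * c q.1) q
      = pdc k a q.1 + q.2 * pdc k b q.1 + q.2 ^ 2 * pdc k c q.1) ∧
    pdZ (fun q => a q.1 + q.2 * b q.1 + q.2 ^ 2 * c q.1) q = b q.1 + 2 * q.2 * c q.1 := by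
  have lift : ∀ {h : E4 → ℂ}, DifferentiableAt ℝ h q.1 →
      DifferentiableAt ℝ (fun q : E4 × ℂ => h q.1) q := fun hh =>
    (hh.hasFDerivAt.comp q hasFDerivAt_fst).differentiableAt
  have hz : DifferentiableAt ℝ (fun q : E4 × ℂ => q.2) q := differentiableAt_snd
  have e : (fun q : E4 × ℂ => a q.1 + q.2 * b q.1 + q.2 ^ 2 * c q.1)
      = fun q => a q.1 + q.2 * (b q.1 + q.2 * c q.1) := by
    funext q; ring
  have h1 := (lift hb).fun_add (hz.fun_mul (lift hc))
  refine ⟨?_, fun k => ?_, ?_⟩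
  · rw [e]
    exact (lift ha).fun_add (hz.fun_mul h1)
  · rw [e, pdX, cdir_add (lift ha) (hz.fun_mul h1), cdir_mul hz h1,
      cdir_add (lift hb) (hz.fun_mul (lift hc)), cdir_mul hz (lift hc)]
    have h0 := pdX_snd k q
    have h1 := pdX_fst k ha
    have h2 := pdX_fst k hb
    have h3 := pdX_fst k hc
    rw [pdX] at h0 h1 h2 h3
    rw [h0, h1, h2, h3]
    ring
  · rw [e, pdZ, cdir_add (lift ha) (hz.fun_mul h1), cdir_mul hz h1,
      cdir_add (lift hb) (hz.fun_mul (lift hc)), cdir_mul hz (lift hc)]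
    have h0 := pdZ_snd q
    have h1 := pdZ_fst ha
    have h2 := pdZ_fst hb
    have h3 := pdZ_fst hc
    rw [pdZ] at h0 h1 h2 h3
    rw [h0, h1, h2, h3]
    ring

/-! ### Moving frames: connection and curvature matrices -/

/-- The entrywise partial derivative `∂ᵢ` of a matrix-valued function. -/
def pdM (i : Fin 4) (M : E4 → Matrix (Fin 4) (Fin 4) ℂ) (y : E4) : Matrix (Fin 4) (Fin 4) ℂ :=
  Matrix.of fun a b => pdc i (fun z => M z a b) y

/-- Entrywise smoothness of a matrix-valued function at a point. -/
def SmoothMat (M : E4 → Matrix (Fin 4) (Fin 4) ℂ) (y : E4) : Prop :=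
  ∀ a b, ContDiffAt ℝ ∞ (fun z => M z a b) y

lemma SmoothMat.differentiableAt {M : E4 → Matrix (Fin 4) (Fin 4) ℂ} {y : E4}
    (h : SmoothMat M y) (a b : Fin 4) : DifferentiableAt ℝ (fun z => M z a b) y :=
  (h a b).differentiableAt (by simp)

lemma SmoothMat.mul {M N : E4 → Matrix (Fin 4) (Fin 4) ℂ} {y : E4}
    (hM : SmoothMat M y) (hN : SmoothMat N y) : SmoothMat (fun z => M z * N z) y := fun a b => by
  simp only [Matrix.mul_apply]
  exact ContDiffAt.sum fun i _ => (hM a i).mul (hN i b)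

lemma SmoothMat.add {M N : E4 → Matrix (Fin 4) (Fin 4) ℂ} {y : E4}
    (hM : SmoothMat M y) (hN : SmoothMat N y) : SmoothMat (fun z => M z + N z) y := fun a b =>
  (hM a b).add (hN a b)

lemma SmoothMat.transpose {M : E4 → Matrix (Fin 4) (Fin 4) ℂ} {y : E4}
    (hM : SmoothMat M y) : SmoothMat (fun z => (M z).transpose) y := fun a b => hM b a

lemma SmoothMat.pdM {M : E4 → Matrix (Fin 4) (Fin 4) ℂ} {y : E4} (i : Fin 4)
    (hM : SmoothMat M y) : SmoothMat (pdM i M) y := fun a b => cdir_contDiffAt _ _ (hM a b)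

lemma SmoothMat.eventually {M : E4 → Matrix (Fin 4) (Fin 4) ℂ} {y : E4} (hM : SmoothMat M y) :
    ∀ᶠ z in 𝓝 y, ∀ a b, DifferentiableAt ℝ (fun z => M z a b) z := by
  simp only [Filter.eventually_all]
  intro a b
  have h := ((hM a b).of_le (m := 1) (by simp)).eventually (by simp)
  exact h.mono fun z hz => hz.differentiableAt (by simp)

lemma pdM_mul (i : Fin 4) {M N : E4 → Matrix (Fin 4) (Fin 4) ℂ} {y : E4}
    (hM : ∀ a b, DifferentiableAt ℝ (fun z => M z a b) y)
    (hN : ∀ a b, DifferentiableAt ℝ (fun z => N z a b) y) :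
    pdM i (fun z => M z * N z) y = pdM i M y * N y + M y * pdM i N y := by
  ext a b
  simp only [pdM, Matrix.of_apply, Matrix.add_apply, Matrix.mul_apply]
  rw [pdc, cdir_sum fun k _ => (hM a k).fun_mul (hN k b), ← Finset.sum_add_distrib]
  refine Finset.sum_congr rfl fun k _ => ?_
  rw [cdir_mul (hM a k) (hN k b)]
  ring

lemma pdM_add (i : Fin 4) {M N : E4 → Matrix (Fin 4) (Fin 4) ℂ} {y : E4}
    (hM : ∀ a b, DifferentiableAt ℝ (fun z => M z a b) y)
    (hN : ∀ a b, DifferentiableAt ℝ (fun z => N z a b) y) :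
    pdM i (fun z => M z + N z) y = pdM i M y + pdM i N y := by
  ext a b
  exact cdir_add (hM a b) (hN a b)

lemma pdM_congr (i : Fin 4) {M N : E4 → Matrix (Fin 4) (Fin 4) ℂ} {y : E4} (h : M =ᶠ[𝓝 y] N) :
    pdM i M y = pdM i N y := by
  ext a b
  exact cdir_congr (h.mono fun z hz => congrFun (congrFun hz a) b)

lemma pdM_const (i : Fin 4) (M : Matrix (Fin 4) (Fin 4) ℂ) (y : E4) :
    pdM i (fun _ => M) y = 0 := by
  ext a b
  exact cdir_const _ _ _ _

lemma pdM_transpose (i : Fin 4) (M : E4 → Matrix (Fin 4) (Fin 4) ℂ) (y : E4) :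
    pdM i (fun z => (M z).transpose) y = (pdM i M y).transpose := rfl

lemma pdM_comm (i j : Fin 4) {M : E4 → Matrix (Fin 4) (Fin 4) ℂ} {y : E4} (hM : SmoothMat M y) :
    pdM i (pdM j M) y = pdM j (pdM i M) y := by
  ext a b
  exact cdir_comm _ _ _ _ (hM a b)

/-- The Gram matrix of a null frame: `e₀, e₁` and `e₂, e₃` are paired to `1`. -/
def nullGram : Matrix (Fin 4) (Fin 4) ℂ := !![0, 1, 0, 0; 1, 0, 0, 0; 0, 0, 0, 1; 0, 0, 1, 0]

/-- The curvature matrices `∂ᵢΓⱼ - ∂ⱼΓᵢ + [Γᵢ, Γⱼ]` of a connection `∂ᵢ + Γᵢ`. -/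
def curvM (Γ : Fin 4 → E4 → Matrix (Fin 4) (Fin 4) ℂ) (i j : Fin 4) (y : E4) :
    Matrix (Fin 4) (Fin 4) ℂ :=
  pdM i (Γ j) y - pdM j (Γ i) y + Γ i y * Γ j y - Γ j y * Γ i y

/-- The connection matrices `E⁻¹ (∂ᵢE + Γᵢ E)` in the frame formed by the columns of `E`, where
`Θ` is the inverse of `E`. -/
def frameConn (Γ : Fin 4 → E4 → Matrix (Fin 4) (Fin 4) ℂ) (E Θ : E4 → Matrix (Fin 4) (Fin 4) ℂ)
    (i : Fin 4) (y : E4) : Matrix (Fin 4) (Fin 4) ℂ :=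
  Θ y * (pdM i E y + Γ i y * E y)

/-- The columns of `E` form a null frame near `y₀` for the metric with matrix `G`, with dual frame
formed by the rows of `Θ`, and `∂ᵢ + Γᵢ` is the Levi-Civita connection of `G`. -/
structure IsNullFrame (G : E4 → Matrix (Fin 4) (Fin 4) ℂ)
    (Γ : Fin 4 → E4 → Matrix (Fin 4) (Fin 4) ℂ) (E Θ : E4 → Matrix (Fin 4) (Fin 4) ℂ)
    (y₀ : E4) : Prop where
  smooth_gram : SmoothMat G y₀
  smooth_conn : ∀ i, SmoothMat (Γ i) y₀
  smooth_frame : SmoothMat E y₀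
  smooth_coframe : SmoothMat Θ y₀
  mul_eq_one : ∀ᶠ y in 𝓝 y₀, E y * Θ y = 1
  gram_eq : ∀ᶠ y in 𝓝 y₀, (E y).transpose * G y * E y = nullGram
  compat : ∀ᶠ y in 𝓝 y₀, ∀ i, pdM i G y = (Γ i y).transpose * G y + G y * Γ i y
  torsion_free : ∀ᶠ y in 𝓝 y₀, ∀ i j k, Γ i y k j = Γ j y k i

namespace IsNullFrame

variable {G : E4 → Matrix (Fin 4) (Fin 4) ℂ} {Γ : Fin 4 → E4 → Matrix (Fin 4) (Fin 4) ℂ}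
  {E Θ : E4 → Matrix (Fin 4) (Fin 4) ℂ} {y₀ : E4}

lemma smooth_frameConn (h : IsNullFrame G Γ E Θ y₀) (i : Fin 4) :
    SmoothMat (frameConn Γ E Θ i) y₀ :=
  h.smooth_coframe.mul ((h.smooth_frame.pdM i).add ((h.smooth_conn i).mul h.smooth_frame))

lemma frame_mul_conn (h : IsNullFrame G Γ E Θ y₀) : ∀ᶠ y in 𝓝 y₀, ∀ i,
    E y * frameConn Γ E Θ i y = pdM i E y + Γ i y * E y := by
  filter_upwards [h.mul_eq_one] with y hy i
  rw [frameConn, ← Matrix.mul_assoc, hy, Matrix.one_mul]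

/-- The connection matrices of a null frame are antisymmetric for the metric. -/
lemma conn_antisymm (h : IsNullFrame G Γ E Θ y₀) : ∀ᶠ y in 𝓝 y₀, ∀ i,
    (frameConn Γ E Θ i y).transpose * nullGram + nullGram * frameConn Γ E Θ i y = 0 := by
  filter_upwards [h.frame_mul_conn, h.compat, h.gram_eq.eventually_nhds, h.smooth_frame.eventually,
    h.smooth_gram.eventually] with y h1 h2 h3 hE hG i
  have h0 : pdM i (fun z => (E z).transpose * G z * E z) y = 0 := by
    rw [pdM_congr i h3, pdM_const]
  have hET : ∀ a b, DifferentiableAt ℝ (fun z => (E z).transpose a b) y := fun a b => hE b a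
  have hEG : ∀ a b, DifferentiableAt ℝ (fun z => ((E z).transpose * G z) a b) y := fun a b => by
    simp only [Matrix.mul_apply]
    exact DifferentiableAt.fun_sum fun k _ => (hET a k).fun_mul (hG k b)
  rw [pdM_mul i hEG hE, pdM_mul i hET hG, pdM_transpose, h2 i,
    eq_sub_of_add_eq (h1 i).symm] at h0
  rw [← h3.self_of_nhds]
  simp only [Matrix.transpose_sub, Matrix.transpose_mul] at h0 ⊢
  rw [← h0]
  noncomm_ring

lemma frame_mul_curv (h : IsNullFrame G Γ E Θ y₀) (i j : Fin 4) :
    E y₀ * curvM (frameConn Γ E Θ) i j y₀ = curvM Γ i j y₀ * E y₀ := by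
  have hω := h.smooth_frameConn
  have key : ∀ i j, pdM i E y₀ * frameConn Γ E Θ j y₀ + E y₀ * pdM i (frameConn Γ E Θ j) y₀
      = pdM i (pdM j E) y₀ + (pdM i (Γ j) y₀ * E y₀ + Γ j y₀ * pdM i E y₀) := by
    intro i j
    rw [← pdM_mul i h.smooth_frame.differentiableAt (hω j).differentiableAt,
      ← pdM_mul i (h.smooth_conn j).differentiableAt h.smooth_frame.differentiableAt,
      ← pdM_add i (h.smooth_frame.pdM j).differentiableAt
        ((h.smooth_conn j).mul h.smooth_frame).differentiableAt]
    exact pdM_congr i (h.frame_mul_conn.mono fun y hy => hy j)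
  have h1 : ∀ i, pdM i E y₀ = E y₀ * frameConn Γ E Θ i y₀ - Γ i y₀ * E y₀ := fun i =>
    eq_sub_of_add_eq (h.frame_mul_conn.self_of_nhds i).symm
  have hij := eq_sub_of_add_eq' (key i j)
  have hji := eq_sub_of_add_eq' (key j i)
  rw [curvM, curvM, Matrix.mul_sub, Matrix.mul_add, Matrix.mul_sub, hij, hji,
    pdM_comm i j h.smooth_frame, h1 i, h1 j]
  noncomm_ring

end IsNullFrame

/-- The involution `0 ↔ 1`, `2 ↔ 3` of the indices of a null frame. -/
def flip4 : Fin 4 → Fin 4 := ![1, 0, 3, 2]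

lemma nullGram_mul_apply (N : Matrix (Fin 4) (Fin 4) ℂ) (c b : Fin 4) :
    (nullGram * N) c b = N (flip4 c) b := by
  rw [Matrix.mul_apply, Fin.sum_univ_four]
  fin_cases c <;> simp [nullGram, flip4]

lemma mul_nullGram_apply (N : Matrix (Fin 4) (Fin 4) ℂ) (c b : Fin 4) :
    (N * nullGram) c b = N c (flip4 b) := by
  rw [Matrix.mul_apply, Fin.sum_univ_four]
  fin_cases b <;> simp [nullGram, flip4]

lemma antisymm_flip {N : Matrix (Fin 4) (Fin 4) ℂ}
    (h : N.transpose * nullGram + nullGram * N = 0) (b c : Fin 4) :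
    N (flip4 c) b = -N (flip4 b) c := by
  have e : (N.transpose * nullGram + nullGram * N) c b = 0 := by rw [h]; rfl
  rw [Matrix.add_apply, nullGram_mul_apply, mul_nullGram_apply, Matrix.transpose_apply] at e
  linear_combination e

/-- The entries of a matrix which is antisymmetric for the null metric. -/
lemma antisymm_entries {N : Matrix (Fin 4) (Fin 4) ℂ}
    (h : N.transpose * nullGram + nullGram * N = 0) :
    N 1 0 = 0 ∧ N 0 1 = 0 ∧ N 3 2 = 0 ∧ N 2 3 = 0 ∧ N 0 0 = -N 1 1 ∧ N 2 2 = -N 3 3 ∧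
      N 1 2 = -N 3 0 ∧ N 2 0 = -N 1 3 ∧ N 0 2 = -N 3 1 ∧ N 0 3 = -N 2 1 := by
  have e := antisymm_flip h
  have zero : ∀ b, N (flip4 b) b = 0 := fun b => self_eq_neg.mp (e b b)
  exact ⟨zero 0, zero 1, zero 2, zero 3, e 0 1, e 2 3, e 2 0, e 0 3, e 2 1, e 3 1⟩

/-! ### The 1-form `A = -g(∇ V, W)` and its curvature -/

/-- The Koszul formula `g(∇_{eₐ} e_b, e_c)` in a null frame with structure functions
`[eₐ, e_b] = ∑ C a b c e_c`. -/
def koszul (C : Fin 4 → Fin 4 → Fin 4 → ℂ) (a b c : Fin 4) : ℂ :=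
  (C a b (flip4 c) - C a c (flip4 b) - C b c (flip4 a)) / 2

lemma koszul_eq {C : Fin 4 → Fin 4 → Fin 4 → ℂ} {N : Fin 4 → Matrix (Fin 4) (Fin 4) ℂ}
    (hN : ∀ a, (N a).transpose * nullGram + nullGram * N a = 0)
    (hC : ∀ a b c, C a b c = N a c b - N b c a) (a b c : Fin 4) :
    koszul C a b c = N a (flip4 c) b := by
  rw [koszul, hC, hC, hC, antisymm_flip (hN a) c b, antisymm_flip (hN b) c a,
    antisymm_flip (hN c) b a]
  ring

/-- The coefficients of `λᵏ` in `-g(∇_{eₐ} V, W)`, where `V = e₃ + λ e₁` and `W = e₀ - λ e₂`, in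
terms of the structure functions `C` of the null frame. -/
def twistorCoeff (C : Fin 4 → Fin 4 → Fin 4 → ℂ) (k : Fin 3) (a : Fin 4) : ℂ :=
  ![-koszul C a 3 0, koszul C a 3 2 - koszul C a 1 0, koszul C a 1 2] k

/-- The coefficients of `λᵏ` in `-g(∇ V, W)`, where `V = e₃ + λ e₁` and `W = e₀ - λ e₂`, in terms
of the connection matrix `N` in the null frame. -/
def connCoeff (N : Matrix (Fin 4) (Fin 4) ℂ) (k : Fin 3) : ℂ :=
  ![-N 1 3, N 3 3 - N 1 1, N 3 1] k

/-- The structure functions `θ_c([eₐ, e_b])` of the frame formed by the columns of `E`, where the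
rows of `Θ` are the dual frame. -/
def structFun (E Θ : E4 → Matrix (Fin 4) (Fin 4) ℂ) (y : E4) (a b c : Fin 4) : ℂ :=
  ∑ k, Θ y c k * ∑ i, (E y i a * pdc i (fun z => E z k b) y - E y i b * pdc i (fun z => E z k a) y)

namespace IsNullFrame

variable {G : E4 → Matrix (Fin 4) (Fin 4) ℂ} {Γ : Fin 4 → E4 → Matrix (Fin 4) (Fin 4) ℂ}
  {E Θ : E4 → Matrix (Fin 4) (Fin 4) ℂ} {y₀ : E4}

/-- The structure functions are the antisymmetrized connection coefficients. -/
lemma structFun_eq {y : E4} (hΓ : ∀ i j k, Γ i y k j = Γ j y k i) (a b c : Fin 4) :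
    structFun E Θ y a b c =
      (∑ i, E y i a • frameConn Γ E Θ i y) c b - (∑ i, E y i b • frameConn Γ E Θ i y) c a := by
  have key : ∀ a b, (∑ i, E y i a • frameConn Γ E Θ i y) c b
      = (∑ k, Θ y c k * ∑ i, E y i a * pdc i (fun z => E z k b) y)
        + ∑ k, Θ y c k * ∑ i, ∑ m, E y i a * (Γ i y k m * E y m b) := by
    intro a b
    simp only [frameConn, Matrix.sum_apply, Matrix.smul_apply, smul_eq_mul, Matrix.mul_apply,
      Matrix.add_apply, pdM, Matrix.of_apply, Finset.mul_sum, mul_add, Finset.sum_add_distrib]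
    congr 1
    · rw [Finset.sum_comm]
      exact Finset.sum_congr rfl fun k _ => Finset.sum_congr rfl fun i _ => by ring
    · rw [Finset.sum_comm]
      exact Finset.sum_congr rfl fun k _ => Finset.sum_congr rfl fun i _ =>
        Finset.sum_congr rfl fun m _ => by ring
  have hsymm : ∀ k, ∑ i, ∑ m, E y i a * (Γ i y k m * E y m b)
      = ∑ i, ∑ m, E y i b * (Γ i y k m * E y m a) := by
    intro k
    rw [Finset.sum_comm]
    refine Finset.sum_congr rfl fun i _ => Finset.sum_congr rfl fun m _ => ?_
    rw [hΓ m i k]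
    ring
  rw [key, key, structFun]
  simp only [hsymm, Finset.sum_sub_distrib, mul_sub]
  ring

/-- The coefficients of the 1-form `-g(∇ V, W)` in coordinates, computed from the structure
functions of the frame. -/
lemma sum_twistorCoeff (h : IsNullFrame G Γ E Θ y₀) : ∀ᶠ y in 𝓝 y₀, ∀ i k,
    ∑ a, twistorCoeff (structFun E Θ y) k a * Θ y a i = connCoeff (frameConn Γ E Θ i y) k := by
  filter_upwards [h.conn_antisymm, h.mul_eq_one, h.torsion_free] with y hN hE hΓ i k
  set N : Fin 4 → Matrix (Fin 4) (Fin 4) ℂ := fun a => ∑ j, E y j a • frameConn Γ E Θ j y with hNdef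
  have hNa : ∀ a, (N a).transpose * nullGram + nullGram * N a = 0 := by
    intro a
    simp only [hNdef, Matrix.transpose_sum, Matrix.transpose_smul, Finset.sum_mul, Finset.mul_sum,
      Matrix.smul_mul, Matrix.mul_smul]
    rw [← Finset.sum_add_distrib]
    refine Finset.sum_eq_zero fun j _ => ?_
    rw [← smul_add, hN j, smul_zero]
  have hC := fun a b c => structFun_eq (E := E) (Θ := Θ) hΓ a b c
  have hk : ∀ a, twistorCoeff (structFun E Θ y) k a = connCoeff (N a) k := by
    intro a
    simp only [twistorCoeff, connCoeff, koszul_eq hNa hC]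
    rfl
  have hsum : ∀ b c, ∑ a, N a b c * Θ y a i = frameConn Γ E Θ i y b c := by
    intro b c
    have h1 : ∀ j, ∑ a, E y j a * Θ y a i = if j = i then 1 else 0 := fun j => by
      rw [← Matrix.mul_apply, hE, Matrix.one_apply]
    calc ∑ a, N a b c * Θ y a i
        = ∑ j, (∑ a, E y j a * Θ y a i) * frameConn Γ E Θ j y b c := by
          simp only [hNdef, Matrix.sum_apply, Matrix.smul_apply, smul_eq_mul, Finset.sum_mul]
          rw [Finset.sum_comm]
          exact Finset.sum_congr rfl fun j _ => Finset.sum_congr rfl fun a _ => by ring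
      _ = frameConn Γ E Θ i y b c := by simp [h1]
  simp only [hk]
  fin_cases k
  · simp [connCoeff, hsum]
  · simp [connCoeff, hsum, sub_mul]
  · simp [connCoeff, hsum]

end IsNullFrame

/-- The value at `λ = z` of a quadratic polynomial in `λ`. -/
def quadVal (c : Fin 3 → ℂ) (z : ℂ) : ℂ := c 0 + z * c 1 + z ^ 2 * c 2

/-- The derivative at `λ = z` of a quadratic polynomial in `λ`. -/
def quadDeriv (c : Fin 3 → ℂ) (z : ℂ) : ℂ := c 1 + 2 * z * c 2

/-- The components of `V = e₃ + λ e₁`, where the columns of `E` are the vectors `eₐ`. -/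
def vecV (E : Matrix (Fin 4) (Fin 4) ℂ) (z : ℂ) (j : Fin 4) : ℂ := E j 3 + z * E j 1

/-- The components of `W = e₀ - λ e₂`, where the columns of `E` are the vectors `eₐ`. -/
def vecW (E : Matrix (Fin 4) (Fin 4) ℂ) (z : ℂ) (j : Fin 4) : ℂ := E j 0 + z * -E j 2

namespace IsNullFrame

variable {G : E4 → Matrix (Fin 4) (Fin 4) ℂ} {Γ : Fin 4 → E4 → Matrix (Fin 4) (Fin 4) ℂ}
  {E Θ : E4 → Matrix (Fin 4) (Fin 4) ℂ} {y₀ : E4}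

lemma pdc_connCoeff (h : IsNullFrame G Γ E Θ y₀) (i j : Fin 4) (k : Fin 3) :
    pdc i (fun y => connCoeff (frameConn Γ E Θ j y) k) y₀
      = connCoeff (pdM i (frameConn Γ E Θ j) y₀) k := by
  have hd := (h.smooth_frameConn j).differentiableAt
  fin_cases k
  · exact pdc_neg _ _ _
  · exact cdir_sub (hd 3 3) (hd 1 1)
  · rfl

/-- The curvature `dA + A ∧ ∂A/∂λ` of the 1-form `A = -g(∇ V, W)` is `-g(R V, W)`. -/
lemma twistor_curvature (h : IsNullFrame G Γ E Θ y₀) (z : ℂ) (i j : Fin 4) :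
    (quadVal (fun k => pdc i (fun y => connCoeff (frameConn Γ E Θ j y) k) y₀) z
        + quadVal (connCoeff (frameConn Γ E Θ i y₀)) z
          * quadDeriv (connCoeff (frameConn Γ E Θ j y₀)) z)
      - (quadVal (fun k => pdc j (fun y => connCoeff (frameConn Γ E Θ i y) k) y₀) z
        + quadVal (connCoeff (frameConn Γ E Θ j y₀)) z
          * quadDeriv (connCoeff (frameConn Γ E Θ i y₀)) z)
      = -∑ k, ∑ l, vecV (E y₀) z k * vecW (E y₀) z l * (G y₀ * curvM Γ i j y₀) l k := by
  have hK : nullGram * curvM (frameConn Γ E Θ) i j y₀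
      = (E y₀).transpose * (G y₀ * curvM Γ i j y₀) * E y₀ := by
    rw [← h.gram_eq.self_of_nhds, Matrix.mul_assoc, h.frame_mul_curv]
    simp only [Matrix.mul_assoc]
  have hKe : ∀ c b, (nullGram * curvM (frameConn Γ E Θ) i j y₀) c b
      = ∑ k, ∑ l, E y₀ l c * (G y₀ * curvM Γ i j y₀) l k * E y₀ k b := by
    intro c b
    rw [hK]
    simp only [Matrix.mul_apply (M := (E y₀).transpose * (G y₀ * curvM Γ i j y₀)),
      Matrix.mul_apply (M := (E y₀).transpose), Matrix.transpose_apply, Finset.sum_mul]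
  have hR : ∑ k, ∑ l, vecV (E y₀) z k * vecW (E y₀) z l * (G y₀ * curvM Γ i j y₀) l k
      = (nullGram * curvM (frameConn Γ E Θ) i j y₀) 0 3
        + z * (nullGram * curvM (frameConn Γ E Θ) i j y₀) 0 1
        - z * (nullGram * curvM (frameConn Γ E Θ) i j y₀) 2 3
        - z ^ 2 * (nullGram * curvM (frameConn Γ E Θ) i j y₀) 2 1 := by
    simp only [hKe, Finset.mul_sum]
    simp only [← Finset.sum_add_distrib, ← Finset.sum_sub_distrib]
    refine Finset.sum_congr rfl fun k _ => Finset.sum_congr rfl fun l _ => ?_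
    simp only [vecV, vecW]
    ring
  rw [hR]
  simp only [h.pdc_connCoeff]
  obtain ⟨i1, i2, i3, i4, i5, i6, i7, i8, i9, i10⟩ :=
    antisymm_entries (h.conn_antisymm.self_of_nhds i)
  obtain ⟨j1, j2, j3, j4, j5, j6, j7, j8, j9, j10⟩ :=
    antisymm_entries (h.conn_antisymm.self_of_nhds j)
  simp [nullGram, Matrix.mul_apply, Fin.sum_univ_four, curvM, quadVal, quadDeriv, connCoeff,
    i1, i2, i3, i4, i7, i8, i9, i10, j1, j2, j3, j4, j7, j8, j9, j10]
  ring

end IsNullFrame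

/-! ### The Lax relation in coordinates -/

lemma liftOp_mul {V A : Fin 4 → E4 × ℂ → ℂ} {F H : E4 × ℂ → ℂ} {q : E4 × ℂ}
    (hF : DifferentiableAt ℝ F q) (hH : DifferentiableAt ℝ H q) :
    liftOp V A (fun q => F q * H q) q = F q * liftOp V A H q + liftOp V A F q * H q := by
  simp only [liftOp, Finset.mul_sum, Finset.sum_mul, pdX, pdZ, cdir_mul hF hH]
  rw [← Finset.sum_add_distrib]
  exact Finset.sum_congr rfl fun i _ => by ring

lemma liftOp_congr {V A : Fin 4 → E4 × ℂ → ℂ} {F H : E4 × ℂ → ℂ} {q : E4 × ℂ}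
    (h : F =ᶠ[𝓝 q] H) : liftOp V A F q = liftOp V A H q := by
  simp only [liftOp, pdX, pdZ, cdir_congr h]

/-- The derivatives of a function which is affine in `λ`. -/
lemma pd_affine {a b : E4 → ℂ} {q : E4 × ℂ} (ha : DifferentiableAt ℝ a q.1)
    (hb : DifferentiableAt ℝ b q.1) :
    DifferentiableAt ℝ (fun q : E4 × ℂ => a q.1 + q.2 * b q.1) q ∧
    (∀ k, pdX k (fun q => a q.1 + q.2 * b q.1) q = pdc k a q.1 + q.2 * pdc k b q.1) ∧
    pdZ (fun q => a q.1 + q.2 * b q.1) q = b q.1 := by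
  have h := pd_quadratic ha hb (differentiableAt_const (0 : ℂ))
  have h0 : ∀ k, pdc k (fun _ => (0 : ℂ)) q.1 = 0 := fun k => cdir_const _ _ _ _
  simpa only [mul_zero, add_zero, h0] using h

lemma pd_vecV {E : E4 → Matrix (Fin 4) (Fin 4) ℂ} {q : E4 × ℂ}
    (hE : ∀ a b, DifferentiableAt ℝ (fun z => E z a b) q.1) (j : Fin 4) :
    DifferentiableAt ℝ (fun q : E4 × ℂ => vecV (E q.1) q.2 j) q ∧
    (∀ k, pdX k (fun q => vecV (E q.1) q.2 j) q
      = pdc k (fun y => E y j 3) q.1 + q.2 * pdc k (fun y => E y j 1) q.1) ∧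
    pdZ (fun q => vecV (E q.1) q.2 j) q = E q.1 j 1 :=
  pd_affine (hE j 3) (hE j 1)

lemma pd_vecW {E : E4 → Matrix (Fin 4) (Fin 4) ℂ} {q : E4 × ℂ}
    (hE : ∀ a b, DifferentiableAt ℝ (fun z => E z a b) q.1) (j : Fin 4) :
    DifferentiableAt ℝ (fun q : E4 × ℂ => vecW (E q.1) q.2 j) q ∧
    (∀ k, pdX k (fun q => vecW (E q.1) q.2 j) q
      = pdc k (fun y => E y j 0) q.1 - q.2 * pdc k (fun y => E y j 2) q.1) ∧
    pdZ (fun q => vecW (E q.1) q.2 j) q = -E q.1 j 2 := by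
  have h := pd_affine (hE j 0) (hE j 2).fun_neg
  simpa only [pdc_neg, mul_neg, ← sub_eq_add_neg, vecW] using h

/-- The horizontal commutator of the lifts of `V = e₃ + λ e₁` and `W = e₀ - λ e₂` is expressed by
the structure functions of the frame, up to terms which are annihilated by `θ₀` and `θ₃`. -/
lemma liftOp_vec_structFun {E Θ : E4 → Matrix (Fin 4) (Fin 4) ℂ} {y : E4} {z : ℂ}
    {A : Fin 4 → E4 × ℂ → ℂ} (hE : ∀ a b, DifferentiableAt ℝ (fun z => E z a b) y)
    (hΘ : Θ y * E y = 1) (c : Fin 4) (hc1 : c ≠ 1) (hc2 : c ≠ 2) :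
    ∑ j, Θ y c j * (liftOp (fun i q => vecV (E q.1) q.2 i) A (fun q => vecW (E q.1) q.2 j) (y, z)
        - liftOp (fun i q => vecW (E q.1) q.2 i) A (fun q => vecV (E q.1) q.2 j) (y, z))
      = quadVal ![structFun E Θ y 3 0 c, structFun E Θ y 1 0 c - structFun E Θ y 3 2 c,
          -structFun E Θ y 1 2 c] z := by
  have h1 : ∑ j, Θ y c j * E y j 1 = 0 := by
    rw [← Matrix.mul_apply, hΘ, Matrix.one_apply_ne hc1]
  have h2 : ∑ j, Θ y c j * E y j 2 = 0 := by
    rw [← Matrix.mul_apply, hΘ, Matrix.one_apply_ne hc2]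
  have hV := fun j => pd_vecV (q := (y, z)) hE j
  have hW := fun j => pd_vecW (q := (y, z)) hE j
  simp only [liftOp, (hV _).2.1, (hV _).2.2, (hW _).2.1, (hW _).2.2]
  have e : ∀ j, (∑ i, vecV (E y) z i * (pdc i (fun y => E y j 0) y - z * pdc i (fun y => E y j 2) y
        + A i (y, z) * -E y j 2))
      - ∑ i, vecW (E y) z i * (pdc i (fun y => E y j 3) y + z * pdc i (fun y => E y j 1) y
        + A i (y, z) * E y j 1)
      = (∑ i, (E y i 3 * pdc i (fun y => E y j 0) y - E y i 0 * pdc i (fun y => E y j 3) y)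
        + z * (∑ i, (E y i 1 * pdc i (fun y => E y j 0) y - E y i 0 * pdc i (fun y => E y j 1) y)
          - ∑ i, (E y i 3 * pdc i (fun y => E y j 2) y - E y i 2 * pdc i (fun y => E y j 3) y))
        - z ^ 2 * ∑ i, (E y i 1 * pdc i (fun y => E y j 2) y - E y i 2 * pdc i (fun y => E y j 1) y))
        - (∑ i, vecV (E y) z i * A i (y, z)) * E y j 2
        - (∑ i, vecW (E y) z i * A i (y, z)) * E y j 1 := by
    intro j
    simp only [Finset.mul_sum, Finset.sum_mul, ← Finset.sum_add_distrib, ← Finset.sum_sub_distrib]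
    refine Finset.sum_congr rfl fun i _ => ?_
    simp only [vecV, vecW]
    ring
  simp only [e]
  have e' : ∀ X Y : ℂ, ∀ f : Fin 4 → ℂ, ∑ j, Θ y c j * (f j - X * E y j 2 - Y * E y j 1)
      = ∑ j, Θ y c j * f j := by
    intro X Y f
    have : ∑ j, Θ y c j * (f j - X * E y j 2 - Y * E y j 1) = ∑ j, Θ y c j * f j
        - X * ∑ j, Θ y c j * E y j 2 - Y * ∑ j, Θ y c j * E y j 1 := by
      simp only [Finset.mul_sum, ← Finset.sum_sub_distrib]
      exact Finset.sum_congr rfl fun j _ => by ring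
    rw [this, h1, h2]
    ring
  rw [e']
  simp only [quadVal, structFun, Matrix.cons_val_zero, Matrix.cons_val_one, Matrix.cons_val]
  simp only [mul_add, mul_sub, Finset.sum_add_distrib, Finset.sum_sub_distrib, mul_neg]
  simp only [mul_left_comm (Θ y c _) (z ^ _), mul_left_comm (Θ y c _) z, ← Finset.mul_sum]
  ring

namespace IsNullFrame

variable {G : E4 → Matrix (Fin 4) (Fin 4) ℂ} {Γ : Fin 4 → E4 → Matrix (Fin 4) (Fin 4) ℂ}
  {E Θ : E4 → Matrix (Fin 4) (Fin 4) ℂ} {y₀ : E4}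

/-- With the 1-form `A = -g(∇ V, W)`, the derivatives `∇ V + A ∂V/∂λ` and `∇ W + A ∂W/∂λ` are
combinations of `V` and `W`. -/
lemma covariant_vec (h : IsNullFrame G Γ E Θ y₀) (z : ℂ) (i : Fin 4) : ∃ a b c d : ℂ, ∀ j,
    pdc i (fun y => E y j 0) y₀ - z * pdc i (fun y => E y j 2) y₀
        + quadVal (connCoeff (frameConn Γ E Θ i y₀)) z * -E y₀ j 2
      = a * vecV (E y₀) z j + b * vecW (E y₀) z j - ∑ m, Γ i y₀ j m * vecW (E y₀) z m ∧
    pdc i (fun y => E y j 3) y₀ + z * pdc i (fun y => E y j 1) y₀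
        + quadVal (connCoeff (frameConn Γ E Θ i y₀)) z * E y₀ j 1
      = c * vecV (E y₀) z j + d * vecW (E y₀) z j - ∑ m, Γ i y₀ j m * vecV (E y₀) z m := by
  set N := frameConn Γ E Θ i y₀ with hN
  obtain ⟨i1, i2, i3, i4, i5, i6, i7, i8, i9, i10⟩ :=
    antisymm_entries (h.conn_antisymm.self_of_nhds i)
  rw [← hN] at i1 i2 i3 i4 i5 i6 i7 i8 i9 i10
  refine ⟨N 3 0, N 0 0 - z * N 0 2, N 3 3 + z * N 3 1, N 0 3, fun j => ?_⟩
  have e : ∀ b, pdc i (fun y => E y j b) y₀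
      = ∑ c, E y₀ j c * N c b - ∑ m, Γ i y₀ j m * E y₀ m b := fun b => by
    have := congrFun (congrFun (h.frame_mul_conn.self_of_nhds i) j) b
    rw [Matrix.add_apply, Matrix.mul_apply, Matrix.mul_apply] at this
    exact eq_sub_of_add_eq this.symm
  simp only [e, Fin.sum_univ_four, vecV, vecW, quadVal, connCoeff, Matrix.cons_val_zero,
    Matrix.cons_val_one, Matrix.cons_val]
  constructor
  · simp only [i1, i3, i5, i6, i7, i8, i9]
    ring
  · simp only [i2, i4, i10]
    ring

/-- The horizontal commutator of the lifts of `V` and `W` is a combination of `V` and `W`. -/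
lemma horizontal_commutator (h : IsNullFrame G Γ E Θ y₀) (z : ℂ) {A : Fin 4 → E4 × ℂ → ℂ}
    (hA : ∀ i, A i (y₀, z) = quadVal (connCoeff (frameConn Γ E Θ i y₀)) z) :
    ∃ a b : ℂ, ∀ j,
      liftOp (fun i q => vecV (E q.1) q.2 i) A (fun q => vecW (E q.1) q.2 j) (y₀, z)
        - liftOp (fun i q => vecW (E q.1) q.2 i) A (fun q => vecV (E q.1) q.2 j) (y₀, z)
      = a * vecV (E y₀) z j + b * vecW (E y₀) z j := by
  choose a b c d habcd using h.covariant_vec z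
  have hE := h.smooth_frame.differentiableAt
  have hV := fun j => pd_vecV (q := (y₀, z)) hE j
  have hW := fun j => pd_vecW (q := (y₀, z)) hE j
  refine ⟨∑ i, (vecV (E y₀) z i * a i - vecW (E y₀) z i * c i),
    ∑ i, (vecV (E y₀) z i * b i - vecW (E y₀) z i * d i), fun j => ?_⟩
  simp only [liftOp, (hV _).2.1, (hV _).2.2, (hW _).2.1, (hW _).2.2, hA, (habcd _ _).1,
    (habcd _ _).2]
  have hsymm : ∑ i, ∑ m, vecV (E y₀) z i * (Γ i y₀ j m * vecW (E y₀) z m)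
      = ∑ i, ∑ m, vecW (E y₀) z i * (Γ i y₀ j m * vecV (E y₀) z m) := by
    rw [Finset.sum_comm]
    refine Finset.sum_congr rfl fun i _ => Finset.sum_congr rfl fun m _ => ?_
    rw [h.torsion_free.self_of_nhds m i j]
    ring
  simp only [mul_sub, Finset.sum_sub_distrib, mul_add, Finset.sum_add_distrib, Finset.sum_mul,
    Finset.mul_sum, sub_mul, hsymm]
  simp only [mul_assoc]
  ring

end IsNullFrame

namespace IsNullFrame

variable {G : E4 → Matrix (Fin 4) (Fin 4) ℂ} {Γ : Fin 4 → E4 → Matrix (Fin 4) (Fin 4) ℂ}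
  {E' Θ' : E4 → Matrix (Fin 4) (Fin 4) ℂ} {y₀ : E4}

/-- The Lax pair relation in coordinates, for a frame `E` which is proportional to a null frame
`E'` of a metric whose curvature vanishes on the plane spanned by `V = e₃ + λ e₁` and
`W = e₀ - λ e₂`. -/
lemma lax_commutator (h : IsNullFrame G Γ E' Θ' y₀) (z : ℂ)
    (hR : ∑ i, ∑ j, ∑ k, ∑ l, vecV (E' y₀) z i * vecW (E' y₀) z j * vecV (E' y₀) z k
      * vecW (E' y₀) z l * (G y₀ * curvM Γ i j y₀) l k = 0)
    {E Θ : E4 → Matrix (Fin 4) (Fin 4) ℂ} {τ : E4 → ℂ} (hτ : DifferentiableAt ℝ τ y₀)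
    (hE : ∀ᶠ y in 𝓝 y₀, E y = τ y • E' y) (hΘ : Θ y₀ * E y₀ = 1)
    {A : Fin 3 → Fin 4 → E4 → ℂ}
    (hA : ∀ᶠ y in 𝓝 y₀, ∀ i k, A k i y = connCoeff (frameConn Γ E' Θ' i y) k)
    {F : E4 × ℂ → ℂ} (hF : ContDiffAt ℝ ∞ F (y₀, z)) :
    let V : Fin 4 → E4 × ℂ → ℂ := fun i q => vecV (E q.1) q.2 i
    let W : Fin 4 → E4 × ℂ → ℂ := fun i q => vecW (E q.1) q.2 i
    let B : Fin 4 → E4 × ℂ → ℂ := fun i q => quadVal (fun k => A k i q.1) q.2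
    let coeff : Fin 4 → Fin 3 → ℂ := fun c => ![structFun E Θ y₀ 3 0 c,
      structFun E Θ y₀ 1 0 c - structFun E Θ y₀ 3 2 c, -structFun E Θ y₀ 1 2 c]
    liftOp V B (liftOp W B F) (y₀, z) - liftOp W B (liftOp V B F) (y₀, z)
      = quadVal (coeff 3) z * liftOp V B F (y₀, z) + quadVal (coeff 0) z * liftOp W B F (y₀, z) := by
  intro V W B coeff
  have hE0 := hE.self_of_nhds
  have hA0 := hA.self_of_nhds
  have hE'd := h.smooth_frame.differentiableAt
  have hEd : ∀ a b, DifferentiableAt ℝ (fun y => E y a b) y₀ := fun a b =>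
    (hτ.fun_mul (hE'd a b)).congr_of_eventuallyEq
      (hE.mono fun y hy => by simp [hy])
  have hAev : ∀ i k, A k i =ᶠ[𝓝 y₀] fun y => connCoeff (frameConn Γ E' Θ' i y) k := fun i k =>
    hA.mono fun y hy => hy i k
  have hN := fun i => (h.smooth_frameConn i).differentiableAt
  have hAd : ∀ i k, DifferentiableAt ℝ (A k i) y₀ := fun i k => by
    refine DifferentiableAt.congr_of_eventuallyEq ?_ (hAev i k)
    fin_cases k
    · exact (hN i 1 3).fun_neg
    · exact (hN i 3 3).fun_sub (hN i 1 1)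
    · exact hN i 3 1
  have hB : ∀ i, DifferentiableAt ℝ (B i) (y₀, z) ∧
      (∀ k, pdX k (B i) (y₀, z) = quadVal (fun n => pdc k
        (fun y => connCoeff (frameConn Γ E' Θ' i y) n) y₀) z) ∧
      pdZ (B i) (y₀, z) = quadDeriv (connCoeff (frameConn Γ E' Θ' i y₀)) z := by
    intro i
    obtain ⟨h1, h2, h3⟩ := pd_quadratic (q := (y₀, z)) (hAd i 0) (hAd i 1) (hAd i 2)
    refine ⟨h1, fun k => (h2 k).trans ?_, h3.trans ?_⟩
    · have e : ∀ n, pdc k (A n i) y₀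
          = pdc k (fun y => connCoeff (frameConn Γ E' Θ' i y) n) y₀ := fun n =>
        cdir_congr (hAev i n)
      simp only [e, quadVal]
    · simp only [hA0, quadDeriv]
  have hBval : ∀ i, B i (y₀, z) = quadVal (connCoeff (frameConn Γ E' Θ' i y₀)) z := fun i => by
    simp only [B, hA0]
  have hV0 : ∀ i, V i (y₀, z) = τ y₀ * vecV (E' y₀) z i := fun i => by
    simp only [V, vecV, hE0, Matrix.smul_apply, smul_eq_mul]
    ring
  have hW0 : ∀ i, W i (y₀, z) = τ y₀ * vecW (E' y₀) z i := fun i => by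
    simp only [W, vecW, hE0, Matrix.smul_apply, smul_eq_mul]
    ring
  have hVd : ∀ j, DifferentiableAt ℝ (V j) (y₀, z) := fun j => (pd_vecV hEd j).1
  have hWd : ∀ j, DifferentiableAt ℝ (W j) (y₀, z) := fun j => (pd_vecW hEd j).1
  -- the horizontal commutator is a combination of `V` and `W`, by rescaling
  have hspan : ∃ a b : ℂ, ∀ j, liftOp V B (W j) (y₀, z) - liftOp W B (V j) (y₀, z)
      = a * V j (y₀, z) + b * W j (y₀, z) := by
    obtain ⟨a, b, hab⟩ := h.horizontal_commutator z hBval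
    set V' : Fin 4 → E4 × ℂ → ℂ := fun i q => vecV (E' q.1) q.2 i with hV'
    set W' : Fin 4 → E4 × ℂ → ℂ := fun i q => vecW (E' q.1) q.2 i with hW'
    have hV'd : ∀ j, DifferentiableAt ℝ (V' j) (y₀, z) := fun j => (pd_vecV hE'd j).1
    have hW'd : ∀ j, DifferentiableAt ℝ (W' j) (y₀, z) := fun j => (pd_vecW hE'd j).1
    have hτd : DifferentiableAt ℝ (fun q : E4 × ℂ => τ q.1) (y₀, z) :=
      (hτ.hasFDerivAt.comp (y₀, z) hasFDerivAt_fst).differentiableAt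
    have hev : ∀ᶠ q in 𝓝 (y₀, z), E q.1 = τ q.1 • E' q.1 :=
      (continuousAt_fst (p := (y₀, z))).eventually hE
    have hVev : ∀ j, V j =ᶠ[𝓝 (y₀, z)] fun q => τ q.1 * V' j q := fun j =>
      hev.mono fun q hq => by
        simp only [V, hV', vecV, hq, Matrix.smul_apply, smul_eq_mul]
        ring
    have hWev : ∀ j, W j =ᶠ[𝓝 (y₀, z)] fun q => τ q.1 * W' j q := fun j =>
      hev.mono fun q hq => by
        simp only [W, hW', vecW, hq, Matrix.smul_apply, smul_eq_mul]
        ring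
    have hVs : ∀ H, liftOp V B H (y₀, z) = τ y₀ * liftOp V' B H (y₀, z) := fun H => by
      simp only [liftOp, hV0, hV', Finset.mul_sum]
      exact Finset.sum_congr rfl fun i _ => by ring
    have hWs : ∀ H, liftOp W B H (y₀, z) = τ y₀ * liftOp W' B H (y₀, z) := fun H => by
      simp only [liftOp, hW0, hW', Finset.mul_sum]
      exact Finset.sum_congr rfl fun i _ => by ring
    refine ⟨τ y₀ * a - liftOp W' B (fun q => τ q.1) (y₀, z),
      τ y₀ * b + liftOp V' B (fun q => τ q.1) (y₀, z), fun j => ?_⟩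
    rw [hVs, hWs, liftOp_congr (hWev j), liftOp_congr (hVev j), liftOp_mul hτd (hW'd j),
      liftOp_mul hτd (hV'd j), hV0, hW0]
    have := hab j
    simp only [hV', hW'] at this ⊢
    linear_combination (τ y₀) ^ 2 * this
  have hT : ∀ j, liftOp V B (W j) (y₀, z) - liftOp W B (V j) (y₀, z)
      = quadVal (coeff 3) z * V j (y₀, z) + quadVal (coeff 0) z * W j (y₀, z) := by
    obtain ⟨a, b, hab⟩ := hspan
    have hΘc : ∀ c d, ∑ j, Θ y₀ c j * E y₀ j d = if c = d then 1 else 0 := fun c d => by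
      rw [← Matrix.mul_apply, hΘ, Matrix.one_apply]
    have hc : ∀ c, c ≠ 1 → c ≠ 2 → quadVal (coeff c) z
        = a * (if c = 3 then 1 else 0) + b * (if c = 0 then 1 else 0) := by
      intro c hc1 hc2
      have e := liftOp_vec_structFun (z := z) (A := B) hEd hΘ c hc1 hc2
      have e1 : quadVal (coeff c) z = a * (∑ j, Θ y₀ c j * E y₀ j 3
            + z * ∑ j, Θ y₀ c j * E y₀ j 1)
          + b * (∑ j, Θ y₀ c j * E y₀ j 0 - z * ∑ j, Θ y₀ c j * E y₀ j 2) := by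
        refine e.symm.trans ?_
        simp only [Finset.mul_sum, ← Finset.sum_add_distrib, ← Finset.sum_sub_distrib]
        refine Finset.sum_congr rfl fun j _ => ?_
        rw [show liftOp (fun i q => vecV (E q.1) q.2 i) B (fun q => vecW (E q.1) q.2 j) (y₀, z)
          - liftOp (fun i q => vecW (E q.1) q.2 i) B (fun q => vecV (E q.1) q.2 j) (y₀, z)
          = a * vecV (E y₀) z j + b * vecW (E y₀) z j from hab j]
        simp only [vecV, vecW]
        ring
      rw [e1]
      simp [hΘc, hc1, hc2]
    intro j
    rw [hc 3 (by decide) (by decide), hc 0 (by decide) (by decide), hab j]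
    simp
  refine liftOp_commutator hVd hWd (fun i => (hB i).1) hF hT ?_
  have e : ∀ i j, pdX i (B j) (y₀, z) + B i (y₀, z) * pdZ (B j) (y₀, z)
      - (pdX j (B i) (y₀, z) + B j (y₀, z) * pdZ (B i) (y₀, z))
      = -∑ k, ∑ l, vecV (E' y₀) z k * vecW (E' y₀) z l * (G y₀ * curvM Γ i j y₀) l k := by
    intro i j
    rw [(hB i).2.1, (hB j).2.1, (hB i).2.2, (hB j).2.2, hBval, hBval]
    exact h.twistor_curvature z i j
  have e2 : ∀ i j, V i (y₀, z) * W j (y₀, z) * (-∑ k, ∑ l, vecV (E' y₀) z k * vecW (E' y₀) z l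
      * (G y₀ * curvM Γ i j y₀) l k)
      = -τ y₀ ^ 2 * ∑ k, ∑ l, vecV (E' y₀) z i * vecW (E' y₀) z j * vecV (E' y₀) z k
      * vecW (E' y₀) z l * (G y₀ * curvM Γ i j y₀) l k := by
    intro i j
    rw [hV0, hW0, mul_neg, neg_mul, neg_inj]
    simp only [Finset.mul_sum]
    exact Finset.sum_congr rfl fun k _ => Finset.sum_congr rfl fun l _ => by ring
  simp only [e, e2, ← Finset.mul_sum]
  rw [hR, mul_zero]

end IsNullFrame

/-! ### The Levi-Civita connection in a chart -/

section

variable {M : Type*} [TopologicalSpace M] [ChartedSpace E4 M] [IsManifold (𝓡 4) ∞ M]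

/-- The Gram matrix of the coordinate vector fields, as a complex matrix. -/
def gramC (g : RMetric M) (p : M) (y : E4) : Matrix (Fin 4) (Fin 4) ℂ :=
  (gram g p y).map Complex.ofRealHom

/-- The matrices `Γᵢ` of the Levi-Civita connection `∂ᵢ + Γᵢ` in the chart at `p`, with complex
entries. -/
def conn (g : RMetric M) (p : M) (i : Fin 4) (y : E4) : Matrix (Fin 4) (Fin 4) ℂ :=
  Matrix.of fun k j => (christoffel g p k i j y : ℂ)

lemma gram_symm (g : RMetric M) (p : M) (y : E4) (i j : Fin 4) :
    gram g p y i j = gram g p y j i :=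
  g.symm _ _ _

lemma christoffel_symm (g : RMetric M) (p : M) (k i j : Fin 4) (y : E4) :
    christoffel g p k i j y = christoffel g p k j i y := by
  simp only [christoffel]
  congr 1
  refine Finset.sum_congr rfl fun l _ => ?_
  have : (fun z => gram g p z i j) = fun z => gram g p z j i := funext fun z => gram_symm g p z i j
  rw [this]
  ring

lemma pdc_ofReal (k : Fin 4) {f : E4 → ℝ} {y : E4} (hf : DifferentiableAt ℝ f y) :
    pdc k (fun z => (f z : ℂ)) y = (pd k f y : ℂ) := by
  have h : HasFDerivAt (fun z => (f z : ℂ)) (Complex.ofRealCLM.comp (fderiv ℝ f y)) y :=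
    Complex.ofRealCLM.hasFDerivAt.comp y hf.hasFDerivAt
  rw [pdc_apply, h.fderiv]
  rfl

/-- Metric compatibility of the Levi-Civita connection,
`∂ᵢ g_{jl} = Γᵐᵢⱼ g_{ml} + Γᵐᵢₗ g_{jm}`. -/
lemma pd_gram (g : RMetric M) (p : M) (y : E4) (hdet : IsUnit (gram g p y).det) (i j l : Fin 4) :
    pd i (fun z => gram g p z j l) y = ∑ m, (christoffel g p m i j y * gram g p y m l
      + gram g p y j m * christoffel g p m i l y) := by
  have hs : ∀ a b, (fun z => gram g p z a b) = fun z => gram g p z b a := fun a b =>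
    funext fun z => gram_symm g p z a b
  have low : ∀ j l, ∑ m, gram g p y l m * christoffel g p m i j y
      = 1 / 2 * (pd i (fun z => gram g p z j l) y + pd j (fun z => gram g p z i l) y
        - pd l (fun z => gram g p z i j) y) := by
    intro j l
    set f : Fin 4 → ℝ := fun l => pd i (fun z => gram g p z j l) y
      + pd j (fun z => gram g p z i l) y - pd l (fun z => gram g p z i j) y with hf
    have h1 : ∀ m, christoffel g p m i j y = 1 / 2 * ((gram g p y)⁻¹.mulVec f) m := fun m => rfl
    have h2 : ∑ m, gram g p y l m * ((gram g p y)⁻¹.mulVec f) m = f l := by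
      have : (gram g p y).mulVec ((gram g p y)⁻¹.mulVec f) = f := by
        rw [Matrix.mulVec_mulVec, Matrix.mul_nonsing_inv _ hdet, Matrix.one_mulVec]
      exact congrFun this l
    simp only [h1]
    change _ = 1 / 2 * f l
    rw [← h2, Finset.mul_sum]
    exact Finset.sum_congr rfl fun m _ => by ring
  have h1 : ∀ m, christoffel g p m i j y * gram g p y m l
      = gram g p y l m * christoffel g p m i j y := fun m => by rw [gram_symm g p y m l, mul_comm]
  rw [Finset.sum_add_distrib]
  simp only [h1, low]
  rw [hs l j, hs i j]
  ring

/-- A null frame for the metric in coordinates gives the data of `IsNullFrame`, with the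
Levi-Civita connection of the chart. The metric and its inverse are smooth because the frame is. -/
lemma isNullFrame_of_gram {g : RMetric M} {p : M} {y₀ : E4}
    {E Θ : E4 → Matrix (Fin 4) (Fin 4) ℂ} (hE : SmoothMat E y₀) (hΘ : SmoothMat Θ y₀)
    (hEΘ : ∀ᶠ y in 𝓝 y₀, E y * Θ y = 1)
    (hG : ∀ᶠ y in 𝓝 y₀, (E y).transpose * gramC g p y * E y = nullGram) :
    IsNullFrame (gramC g p) (conn g p) E Θ y₀ ∧
      (∀ i j k, DifferentiableAt ℝ (christoffel g p k i j) y₀) := by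
  have hη : nullGram * nullGram = 1 := by
    ext a b
    rw [nullGram_mul_apply]
    fin_cases a <;> fin_cases b <;> simp [nullGram, flip4]
  have hGinv : ∀ᶠ y in 𝓝 y₀, gramC g p y * (E y * nullGram * (E y).transpose) = 1 := by
    filter_upwards [hEΘ, hG] with y h1 h2
    have h3 : Θ y * E y = 1 := mul_eq_one_comm.mp h1
    calc gramC g p y * (E y * nullGram * (E y).transpose)
        = (E y * Θ y).transpose * gramC g p y * (E y * nullGram * (E y).transpose) := by
          rw [h1, Matrix.transpose_one, Matrix.one_mul]
      _ = (Θ y).transpose * ((E y).transpose * gramC g p y * E y) * nullGram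
          * (E y).transpose := by
          rw [Matrix.transpose_mul]; simp only [Matrix.mul_assoc]
      _ = (E y * Θ y).transpose := by
          rw [h2, Matrix.mul_assoc (Θ y).transpose, hη, Matrix.mul_one, Matrix.transpose_mul]
      _ = 1 := by rw [h1, Matrix.transpose_one]
  have hGeq : ∀ᶠ y in 𝓝 y₀, gramC g p y = (Θ y).transpose * nullGram * Θ y := by
    filter_upwards [hEΘ, hG] with y h1 h2
    rw [← h2]
    calc gramC g p y = (E y * Θ y).transpose * gramC g p y * (E y * Θ y) := by
          rw [h1, Matrix.transpose_one, Matrix.one_mul, Matrix.mul_one]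
      _ = _ := by rw [Matrix.transpose_mul]; simp only [Matrix.mul_assoc]
  have hηs : ∀ y, SmoothMat (fun _ => nullGram) y := fun y a b => contDiffAt_const
  have hGs : SmoothMat (gramC g p) y₀ := fun a b =>
    ((hΘ.transpose.mul (hηs y₀)).mul hΘ a b).congr_of_eventuallyEq
      (hGeq.mono fun y hy => congrFun (congrFun hy a) b)
  have hdet : ∀ᶠ y in 𝓝 y₀, IsUnit (gram g p y).det := by
    filter_upwards [hGinv] with y hy
    have h1 : IsUnit (gramC g p y).det := by
      refine IsUnit.of_mul_eq_one ((E y * nullGram * (E y).transpose).det) ?_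
      rw [← Matrix.det_mul, hy, Matrix.det_one]
    have h2 : (gramC g p y).det = Complex.ofRealHom (gram g p y).det := by
      rw [gramC, RingHom.map_det, RingHom.mapMatrix_apply]
    rw [h2] at h1
    rw [isUnit_iff_ne_zero] at h1 ⊢
    intro h0
    exact h1 (by rw [h0, map_zero])
  have hinv : ∀ᶠ y in 𝓝 y₀, ∀ a b,
      (gram g p y)⁻¹ a b = ((E y * nullGram * (E y).transpose) a b).re := by
    filter_upwards [hGinv, hdet] with y h1 h2 a b
    have h3 : gramC g p y * ((gram g p y)⁻¹).map Complex.ofRealHom = 1 := by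
      rw [gramC, ← Matrix.map_mul, Matrix.mul_nonsing_inv _ h2]
      simp
    have h4 : E y * nullGram * (E y).transpose = ((gram g p y)⁻¹).map Complex.ofRealHom := by
      have h5 := mul_eq_one_comm.mp h3
      calc E y * nullGram * (E y).transpose
          = (((gram g p y)⁻¹).map Complex.ofRealHom * gramC g p y)
            * (E y * nullGram * (E y).transpose) := by rw [h5, Matrix.one_mul]
        _ = _ := by rw [Matrix.mul_assoc, h1, Matrix.mul_one]
    rw [h4]
    simp
  have reS : ∀ {f : E4 → ℂ}, ContDiffAt ℝ ∞ f y₀ → ContDiffAt ℝ ∞ (fun y => (f y).re) y₀ :=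
    fun hf => Complex.reCLM.contDiff.contDiffAt.comp y₀ hf
  have hgram : ∀ a b, ContDiffAt ℝ ∞ (fun y => gram g p y a b) y₀ := fun a b => reS (hGs a b)
  have hinvS : ∀ a b, ContDiffAt ℝ ∞ (fun y => (gram g p y)⁻¹ a b) y₀ := fun a b =>
    (reS ((hE.mul (hηs y₀)).mul hE.transpose a b)).congr_of_eventuallyEq
      (hinv.mono fun y hy => hy a b)
  have hpd : ∀ i a b, ContDiffAt ℝ ∞ (pd i fun y => gram g p y a b) y₀ := fun i a b =>
    ((hgram a b).fderiv_right (m := ∞) (by simp)).clm_apply contDiffAt_const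
  have hchr : ∀ k i j, ContDiffAt ℝ ∞ (christoffel g p k i j) y₀ := fun k i j =>
    contDiffAt_const.mul (ContDiffAt.sum fun l _ =>
      (hinvS k l).mul (((hpd i j l).add (hpd j i l)).sub (hpd l i j)))
  refine ⟨⟨hGs, fun i k j => ?_, hE, hΘ, hEΘ, hG, ?_, ?_⟩,
    fun i j k => (hchr k i j).differentiableAt (by simp)⟩
  · exact Complex.ofRealCLM.contDiff.contDiffAt.comp y₀ (hchr k i j)
  · have hd : ∀ᶠ y in 𝓝 y₀, ∀ a b, DifferentiableAt ℝ (fun z => gram g p z a b) y := by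
      simp only [Filter.eventually_all]
      intro a b
      exact (((hgram a b).of_le (m := 1) (by simp)).eventually (by simp)).mono
        fun z hz => hz.differentiableAt (by simp)
    filter_upwards [hdet, hd] with y h1 h2 i
    ext j l
    have h3 : pdM i (gramC g p) y j l = (pd i (fun z => gram g p z j l) y : ℂ) :=
      pdc_ofReal i (h2 j l)
    rw [h3, pd_gram g p y h1, Matrix.add_apply, Matrix.mul_apply, Matrix.mul_apply,
      ← Finset.sum_add_distrib]
    push_cast
    rfl
  · refine Filter.Eventually.of_forall fun y i j k => ?_
    simp only [conn, Matrix.of_apply]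
    rw [christoffel_symm]

/-- The curvature matrices of the Levi-Civita connection are given by the Riemann tensor. -/
lemma gramC_mul_curvM {g : RMetric M} {p : M} {y : E4}
    (h : ∀ i j k, DifferentiableAt ℝ (christoffel g p k i j) y) (i j k l : Fin 4) :
    (gramC g p y * curvM (conn g p) i j y) l k = (riemann g p i j k l y : ℂ) := by
  have h1 : ∀ m, curvM (conn g p) i j y m k = (riemannUp g p m k i j y : ℂ) := by
    intro m
    have h2 : ∀ i j, pdM i (conn g p j) y m k = (pd i (christoffel g p m j k) y : ℂ) := fun i j =>
      pdc_ofReal i (h j k m)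
    simp only [curvM, Matrix.add_apply, Matrix.sub_apply, h2, riemannUp, Matrix.mul_apply, conn,
      Matrix.of_apply, Finset.sum_sub_distrib]
    push_cast
    ring
  simp only [Matrix.mul_apply, h1, riemann]
  push_cast
  rfl

end

/-! ### Self-duality of the null planes and the Weyl tensor -/

/-- The coordinates of `V = e₃ + λ e₁` in the null frame. -/
def frameV (z : ℂ) : Fin 4 → ℂ := ![0, z, 0, 1]

/-- The coordinates of `W = e₀ - λ e₂` in the null frame. -/
def frameW (z : ℂ) : Fin 4 → ℂ := ![1, 0, -z, 0]

/-- The bivector `V ∧ W` is self-dual: if `p, q` are the coordinates of `V, W` in an orthonormal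
basis which the null coframe maps to a matrix `P` of determinant `1`, then
`det (p, q, x, y) = (p·x)(q·y) - (p·y)(q·x)`. -/
lemma det_null_plane {P : Matrix (Fin 4) (Fin 4) ℂ}
    (hP : P.transpose * nullGram * P = 1) (hdet : P.det = 1) {z : ℂ} {p q : Fin 4 → ℂ}
    (hp : P.mulVec p = frameV z) (hq : P.mulVec q = frameW z) (x y : Fin 4 → ℂ) :
    (Matrix.of ![p, q, x, y]).det
      = (∑ i, p i * x i) * (∑ i, q i * y i) - (∑ i, p i * y i) * ∑ i, q i * x i := by
  have hdot : ∀ u v : Fin 4 → ℂ, ∑ i, u i * v i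
      = dotProduct (P.mulVec u) (nullGram.mulVec (P.mulVec v)) := by
    intro u v
    have e : dotProduct u ((P.transpose * nullGram * P).mulVec v) = ∑ i, u i * v i := by
      rw [hP, Matrix.one_mulVec]
      rfl
    rw [← e, ← Matrix.mulVec_mulVec, ← Matrix.mulVec_mulVec, Matrix.dotProduct_mulVec,
      Matrix.vecMul_transpose]
  have hmul : Matrix.of ![p, q, x, y] * P.transpose
      = Matrix.of ![frameV z, frameW z, P.mulVec x, P.mulVec y] := by
    ext a b
    rw [← hp, ← hq]
    fin_cases a <;> simp [Matrix.mul_apply, Matrix.mulVec, dotProduct, mul_comm]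
  have h1 : (Matrix.of ![p, q, x, y]).det
      = (Matrix.of ![frameV z, frameW z, P.mulVec x, P.mulVec y]).det := by
    rw [← hmul, Matrix.det_mul, Matrix.det_transpose, hdet, mul_one]
  rw [h1, hdot, hdot, hdot, hdot, hp, hq]
  generalize P.mulVec x = x
  generalize P.mulVec y = y
  simp [Matrix.det_succ_row_zero, Fin.sum_univ_succ, Fin.succAbove, frameV, frameW, dotProduct,
    Matrix.mulVec, nullGram]
  ring

/-- The contraction of a bivector of the form `V ∧ W` as in `det_null_plane` with a form that
annihilates the self-dual combinations vanishes. -/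
lemma selfDual_contraction {P : Matrix (Fin 4) (Fin 4) ℂ}
    (hP : P.transpose * nullGram * P = 1) (hdet : P.det = 1) {z : ℂ} {p q : Fin 4 → ℂ}
    (hp : P.mulVec p = frameV z) (hq : P.mulVec q = frameW z) {T : Fin 4 → Fin 4 → ℂ}
    (hT : ∀ a b, T a b = -T b a) (h1 : T 0 1 + T 2 3 = 0) (h2 : T 0 2 + T 3 1 = 0)
    (h3 : T 0 3 + T 1 2 = 0) :
    ∑ a, ∑ b, p a * q b * T a b = 0 := by
  have d := det_null_plane hP hdet hp hq
  have d1 := d ![0, 0, 1, 0] ![0, 0, 0, 1]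
  have d2 := d ![0, 0, 0, 1] ![0, 1, 0, 0]
  have d3 := d ![0, 1, 0, 0] ![0, 0, 1, 0]
  simp [Matrix.det_succ_row_zero, Fin.sum_univ_succ, Fin.succAbove] at d1 d2 d3
  have t0 : ∀ a, T a a = 0 := fun a => self_eq_neg.mp (hT a a)
  simp only [Fin.sum_univ_four, t0]
  rw [hT 1 0, hT 2 0, hT 3 0, hT 2 1, hT 1 3, hT 3 2]
  linear_combination (p 0 * q 1 - p 1 * q 0) * h1 + (p 0 * q 2 - p 2 * q 0) * h2
    + (p 0 * q 3 - p 3 * q 0) * h3 - T 2 3 * d1 - T 3 1 * d2 - T 1 2 * d3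

section

variable {M : Type*} [TopologicalSpace M] [ChartedSpace E4 M] [IsManifold (𝓡 4) ∞ M]

lemma exists_orientedOrthonormal (o : ManifoldOrientation M) (g : RMetric M) (x : M) :
    ∃ b : Module.Basis (Fin 4) ℝ (TangentSpace (𝓡 4) x), IsOrientedOrthonormal o g x b := by
  obtain ⟨b, hb⟩ : ∃ b : Module.Basis (Fin 4) ℝ (TangentSpace (𝓡 4) x),
      ∀ i j, g.inner x (b i) (b j) = if i = j then 1 else 0 := by
    let cd := g.toRiemannianMetric.toCore x
    let _ : NormedAddCommGroup (TangentSpace (𝓡 4) x) := cd.toNormedAddCommGroup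
    let _ : InnerProductSpace ℝ (TangentSpace (𝓡 4) x) := InnerProductSpace.ofCore cd.toCore
    have hfd : FiniteDimensional ℝ (TangentSpace (𝓡 4) x) :=
      inferInstanceAs (FiniteDimensional ℝ E4)
    have hrk : Module.finrank ℝ (TangentSpace (𝓡 4) x) = 4 :=
      (finrank_euclideanSpace_fin (𝕜 := ℝ) (n := 4))
    let ob := (stdOrthonormalBasis ℝ (TangentSpace (𝓡 4) x)).reindex (finCongr hrk)
    refine ⟨ob.toBasis, fun i j => ?_⟩
    have h := orthonormal_iff_ite.mp ob.orthonormal i j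
    simpa using! h
  refine ⟨b.adjustToOrientation (o.orient x), b.orientation_adjustToOrientation _, fun i j => ?_⟩
  rcases b.adjustToOrientation_apply_eq_or_eq_neg (o.orient x) i with hi | hi <;>
  rcases b.adjustToOrientation_apply_eq_or_eq_neg (o.orient x) j with hj | hj
  · rw [hi, hj, hb]
  · by_cases hij : i = j
    · subst hij
      rw [hi, hb]
    · rw [hi, hj, map_neg, hb, if_neg hij, neg_zero]
  · by_cases hij : i = j
    · subst hij
      rw [hj, hb]
    · rw [hi, hj, map_neg, neg_apply, hb, if_neg hij, neg_zero]
  · rw [hi, hj, map_neg, map_neg, neg_apply, neg_neg, hb]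

/-- Scaling by a positive factor turns an oriented orthonormal basis of one metric into one of a
conformal metric. -/
lemma IsOrientedOrthonormal.scale {o : ManifoldOrientation M} {g g' : RMetric M} {x : M}
    {b : Module.Basis (Fin 4) ℝ (TangentSpace (𝓡 4) x)} (hb : IsOrientedOrthonormal o g x b)
    {r : ℝ} (hr : 0 < r) (h : ∀ v w, g'.inner x v w = (r⁻¹) ^ 2 * g.inner x v w) :
    ∃ b' : Module.Basis (Fin 4) ℝ (TangentSpace (𝓡 4) x), IsOrientedOrthonormal o g' x b' ∧
      ∀ i, b' i = r • b i := by
  refine ⟨b.unitsSMul fun _ => Units.mk0 r hr.ne', ⟨?_, fun i j => ?_⟩, fun i => ?_⟩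
  · rw [← hb.1, eq_comm, Module.Basis.orientation_eq_iff_det_pos]
    have e : (b.unitsSMul fun _ => Units.mk0 r hr.ne' : Fin 4 → TangentSpace (𝓡 4) x)
        = fun i => r • b i := by
      ext i : 1
      rw [Module.Basis.unitsSMul_apply]
      rfl
    rw [e, AlternatingMap.map_smul_univ (b.det) (fun _ => r) b, Module.Basis.det_self]
    simp only [Finset.prod_const, smul_eq_mul, mul_one]
    positivity
  · rw [Module.Basis.unitsSMul_apply, Module.Basis.unitsSMul_apply, h]
    simp only [Units.smul_mk0, map_smul, smul_apply, smul_eq_mul, hb.2]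
    split_ifs
    · field_simp
    · simp
  · rw [Module.Basis.unitsSMul_apply]
    rfl

/-- Even permutations preserve oriented orthonormal bases. -/
lemma IsOrientedOrthonormal.perm {o : ManifoldOrientation M} {g : RMetric M} {x : M}
    {b : Module.Basis (Fin 4) ℝ (TangentSpace (𝓡 4) x)} (hb : IsOrientedOrthonormal o g x b)
    (σ : Equiv.Perm (Fin 4)) (hσ : Equiv.Perm.sign σ = 1) :
    IsOrientedOrthonormal o g x (b.reindex σ.symm) := by
  refine ⟨?_, fun i j => ?_⟩
  · rw [← hb.1, eq_comm, Module.Basis.orientation_eq_iff_det_pos]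
    have e : (b.reindex σ.symm : Fin 4 → TangentSpace (𝓡 4) x) = b ∘ σ := by
      ext i : 1
      simp
    rw [e, AlternatingMap.map_perm, hσ, one_smul, Module.Basis.det_self]
    exact one_pos
  · simp [hb.2]

end

/-! ### Vector fields and forms in a chart -/

section

variable {M : Type*} [TopologicalSpace M] [ChartedSpace E4 M]

lemma extChartAt_target_nhds {p : M} {y : E4} (hy : y ∈ (extChartAt (𝓡 4) p).target) :
    (extChartAt (𝓡 4) p).target ∈ 𝓝 y :=
  (isOpen_extChartAt_target p).mem_nhds hy

variable [IsManifold (𝓡 4) ∞ M]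

/-- The coordinates, at the point with coordinates `y` in the chart at `p`, of a vector field. -/
def chartVec (p : M) (X : (x : M) → TangentSpace (𝓡 4) x) (y : E4) : E4 :=
  mfderiv (𝓡 4) 𝓘(ℝ, E4) (extChartAt (𝓡 4) p) ((extChartAt (𝓡 4) p).symm y)
    (X ((extChartAt (𝓡 4) p).symm y))

lemma mdifferentiableAt_extChartAt_symm {p : M} {y : E4} (hy : y ∈ (extChartAt (𝓡 4) p).target) :
    MDifferentiableAt 𝓘(ℝ, E4) (𝓡 4) (extChartAt (𝓡 4) p).symm y := by
  have := mdifferentiableWithinAt_extChartAt_symm (I := 𝓡 4) hy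
  rwa [ModelWithCorners.range_eq_univ, mdifferentiableWithinAt_univ] at this

lemma mfderiv_extChartAt_symm_comp {p : M} {y : E4} (hy : y ∈ (extChartAt (𝓡 4) p).target)
    (v : TangentSpace (𝓡 4) ((extChartAt (𝓡 4) p).symm y)) :
    mfderiv 𝓘(ℝ, E4) (𝓡 4) (extChartAt (𝓡 4) p).symm y
      (mfderiv (𝓡 4) 𝓘(ℝ, E4) (extChartAt (𝓡 4) p) ((extChartAt (𝓡 4) p).symm y) v) = v := by
  have := mfderivWithin_extChartAt_symm_comp_mfderiv_extChartAt (I := 𝓡 4) hy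
  rw [ModelWithCorners.range_eq_univ, mfderivWithin_univ] at this
  exact DFunLike.congr_fun this v

lemma mfderiv_extChartAt_comp_symm {p : M} {y : E4} (hy : y ∈ (extChartAt (𝓡 4) p).target)
    (v : E4) :
    mfderiv (𝓡 4) 𝓘(ℝ, E4) (extChartAt (𝓡 4) p) ((extChartAt (𝓡 4) p).symm y)
      (mfderiv 𝓘(ℝ, E4) (𝓡 4) (extChartAt (𝓡 4) p).symm y v) = v := by
  have := mfderiv_extChartAt_comp_mfderivWithin_extChartAt_symm (I := 𝓡 4) hy
  rw [ModelWithCorners.range_eq_univ, mfderivWithin_univ] at this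
  exact DFunLike.congr_fun this v

lemma clm_eq_sum {T : Type*} [AddCommGroup T] [Module ℝ T] [TopologicalSpace T] (L : E4 →L[ℝ] T)
    (w : E4) : L w = ∑ i, w i • L (EuclideanSpace.single i (1 : ℝ)) := by
  have h : w = ∑ i, w i • EuclideanSpace.single i (1 : ℝ) := by
    ext j
    simp [Finset.sum_apply, Pi.single_apply]
  conv_lhs => rw [h]
  rw [map_sum]
  exact Finset.sum_congr rfl fun i _ => map_smul _ _ _

/-- A vector field is the combination of the coordinate vector fields given by its coordinates. -/
lemma sum_chartVec {p : M} {y : E4} (hy : y ∈ (extChartAt (𝓡 4) p).target)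
    (X : (x : M) → TangentSpace (𝓡 4) x) :
    X ((extChartAt (𝓡 4) p).symm y) = ∑ i, (chartVec p X y i) • coordVec p y i := by
  have h := mfderiv_extChartAt_symm_comp hy (X ((extChartAt (𝓡 4) p).symm y))
  exact h.symm.trans (clm_eq_sum (mfderiv 𝓘(ℝ, E4) (𝓡 4) (extChartAt (𝓡 4) p).symm y)
    (chartVec p X y))

/-- The coordinates of a complex vector field in the chart at `p`. -/
def CVec.comp (X : CVec M) (p : M) (i : Fin 4) (y : E4) : ℂ :=
  (chartVec p X.re y i : ℂ) + Complex.I * (chartVec p X.im y i : ℂ)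

lemma pair_eq_sum {p : M} {y : E4} (hy : y ∈ (extChartAt (𝓡 4) p).target) (X : CVec M)
    (ξ : TangentSpace (𝓡 4) ((extChartAt (𝓡 4) p).symm y) →L[ℝ] ℂ) :
    pair ((extChartAt (𝓡 4) p).symm y) ξ X = ∑ i, X.comp p i y * ξ (coordVec p y i) := by
  simp only [pair, CVec.comp]
  rw [sum_chartVec hy X.re, sum_chartVec hy X.im, map_sum, map_sum, Finset.mul_sum,
    ← Finset.sum_add_distrib]
  refine Finset.sum_congr rfl fun i _ => ?_
  rw [map_smul, map_smul, Complex.real_smul, Complex.real_smul]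
  ring

lemma contDiffAt_chartVec {p : M} {y : E4} (hy : y ∈ (extChartAt (𝓡 4) p).target)
    {X : (x : M) → TangentSpace (𝓡 4) x}
    (hX : ContMDiffAt (𝓡 4) (𝓡 4).tangent ∞ (fun x => (⟨x, X x⟩ : TangentBundle (𝓡 4) M))
      ((extChartAt (𝓡 4) p).symm y)) :
    ContDiffAt ℝ ∞ (chartVec p X) y := by
  have hs := (extChartAt (𝓡 4) p).map_target hy
  have hs' : (extChartAt (𝓡 4) p).symm y ∈ (chartAt E4 p).source := by
    rwa [extChartAt_source] at hs
  have h1 := ((trivializationAt E4 (TangentSpace (𝓡 4)) p).contMDiffAt_section_iff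
    (s := X) (IB := 𝓡 4) (n := ∞) (by simpa using hs')).mp hX
  have h2 : ContMDiffAt 𝓘(ℝ, E4) (𝓡 4) ∞ (extChartAt (𝓡 4) p).symm y :=
    (contMDiffOn_extChartAt_symm p).contMDiffAt (extChartAt_target_nhds hy)
  have h3 := (h1.comp y h2).contDiffAt
  refine h3.congr_of_eventuallyEq ?_
  filter_upwards [extChartAt_target_nhds hy] with z hz
  have hzs := (extChartAt (𝓡 4) p).map_target hz
  rw [extChartAt_source] at hzs
  have h4 := TangentBundle.continuousLinearMapAt_trivializationAt (I := 𝓡 4) hzs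
  have h5 : (trivializationAt E4 (TangentSpace (𝓡 4)) p).continuousLinearMapAt ℝ
      ((extChartAt (𝓡 4) p).symm z) (X ((extChartAt (𝓡 4) p).symm z))
      = (trivializationAt E4 (TangentSpace (𝓡 4)) p ⟨_, X ((extChartAt (𝓡 4) p).symm z)⟩).2 := by
    rw [Bundle.Trivialization.continuousLinearMapAt_apply,
      Bundle.Trivialization.linearMapAt_apply, if_pos (by simpa using hzs)]
  exact (DFunLike.congr_fun h4 (X ((extChartAt (𝓡 4) p).symm z))).symm.trans h5

lemma contDiffAt_comp {p : M} {y : E4} (hy : y ∈ (extChartAt (𝓡 4) p).target) {X : CVec M}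
    {U : Set M} (hU : IsOpen U) (hyU : (extChartAt (𝓡 4) p).symm y ∈ U) (hX : X.SmoothOn U)
    (i : Fin 4) : ContDiffAt ℝ ∞ (X.comp p i) y := by
  have h : ∀ Y : (x : M) → TangentSpace (𝓡 4) x,
      ContMDiffOn (𝓡 4) (𝓡 4).tangent ∞ (fun x => (⟨x, Y x⟩ : TangentBundle (𝓡 4) M)) U →
      ContDiffAt ℝ ∞ (fun y => (chartVec p Y y i : ℂ)) y := fun Y hY =>
    Complex.ofRealCLM.contDiff.contDiffAt.comp y
      ((EuclideanSpace.proj (𝕜 := ℝ) i).contDiff.contDiffAt.comp y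
        (contDiffAt_chartVec hy (hY.contMDiffAt (hU.mem_nhds hyU))))
  exact (h _ hX.1).add (contDiffAt_const.mul (h _ hX.2))

/-- The Lie bracket of complex vector fields. -/
def CVec.bracket (X Y : CVec M) : CVec M where
  re x := VectorField.mlieBracket (𝓡 4) X.re Y.re x - VectorField.mlieBracket (𝓡 4) X.im Y.im x
  im x := VectorField.mlieBracket (𝓡 4) X.re Y.im x + VectorField.mlieBracket (𝓡 4) X.im Y.re x

lemma chartVec_mlieBracket {p : M} {y : E4} (hy : y ∈ (extChartAt (𝓡 4) p).target)
    {X Y : (x : M) → TangentSpace (𝓡 4) x}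
    (hX : ContMDiffAt (𝓡 4) (𝓡 4).tangent ∞ (fun x => (⟨x, X x⟩ : TangentBundle (𝓡 4) M))
      ((extChartAt (𝓡 4) p).symm y))
    (hY : ContMDiffAt (𝓡 4) (𝓡 4).tangent ∞ (fun x => (⟨x, Y x⟩ : TangentBundle (𝓡 4) M))
      ((extChartAt (𝓡 4) p).symm y)) (i : Fin 4) :
    chartVec p (VectorField.mlieBracket (𝓡 4) X Y) y i
      = ∑ j, (chartVec p X y j * pd j (fun y => chartVec p Y y i) y
        - chartVec p Y y j * pd j (fun y => chartVec p X y i) y) := by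
  have h2 : ContMDiffAt 𝓘(ℝ, E4) (𝓡 4) ∞ (extChartAt (𝓡 4) p).symm y :=
    (contMDiffOn_extChartAt_symm p).contMDiffAt (extChartAt_target_nhds hy)
  have hinv : ∀ z ∈ (extChartAt (𝓡 4) p).target,
      (mfderiv 𝓘(ℝ, E4) (𝓡 4) (extChartAt (𝓡 4) p).symm z).inverse
        = mfderiv (𝓡 4) 𝓘(ℝ, E4) (extChartAt (𝓡 4) p) ((extChartAt (𝓡 4) p).symm z) := by
    intro z hz
    apply ContinuousLinearMap.inverse_eq
    · ext v
      exact mfderiv_extChartAt_symm_comp hz v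
    · ext v : 1
      exact mfderiv_extChartAt_comp_symm hz v
  have hpull : ∀ Z : (x : M) → TangentSpace (𝓡 4) x, ∀ z ∈ (extChartAt (𝓡 4) p).target,
      VectorField.mpullback 𝓘(ℝ, E4) (𝓡 4) (extChartAt (𝓡 4) p).symm Z z = chartVec p Z z := by
    intro Z z hz
    rw [VectorField.mpullback_apply, hinv z hz]
    rfl
  have hev : ∀ Z : (x : M) → TangentSpace (𝓡 4) x,
      VectorField.mpullback 𝓘(ℝ, E4) (𝓡 4) (extChartAt (𝓡 4) p).symm Z =ᶠ[𝓝 y] chartVec p Z :=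
    fun Z => by
      filter_upwards [extChartAt_target_nhds hy] with z hz using hpull Z z hz
  have hle : minSmoothness ℝ 2 ≤ ∞ := by
    rw [minSmoothness_of_isRCLikeNormedField]
    exact ENat.LEInfty.out
  have : IsManifold (𝓡 4) (minSmoothness ℝ 2) M := IsManifold.of_le hle
  have hb := VectorField.mpullback_mlieBracket (n := ∞) (hX.mdifferentiableAt (by simp))
    (hY.mdifferentiableAt (by simp)) h2 hle
  rw [hpull _ y hy, (hev X).mlieBracket_vectorField_eq (hev Y)] at hb
  have hflat : ∀ Z Z' : E4 → E4, VectorField.mlieBracket 𝓘(ℝ, E4) Z Z' y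
      = fderiv ℝ Z' y (Z y) - fderiv ℝ Z y (Z' y) := by
    intro Z Z'
    have e : VectorField.mlieBracketWithin 𝓘(ℝ, E4) Z Z' Set.univ y
        = VectorField.lieBracketWithin ℝ Z Z' Set.univ y :=
      congrFun VectorField.mlieBracketWithin_eq_lieBracketWithin y
    rw [VectorField.lieBracketWithin_univ] at e
    exact e
  have hb' := hb.trans (hflat (chartVec p X) (chartVec p Y))
  have hpd : ∀ {Z : (x : M) → TangentSpace (𝓡 4) x}, DifferentiableAt ℝ (chartVec p Z) y →
      ∀ w : E4, (fderiv ℝ (chartVec p Z) y w) i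
        = ∑ j, w j * pd j (fun y => chartVec p Z y i) y := by
    intro Z hZ w
    have h1 : HasFDerivAt (fun y => chartVec p Z y i)
        ((EuclideanSpace.proj (𝕜 := ℝ) i).comp (fderiv ℝ (chartVec p Z) y)) y :=
      (EuclideanSpace.proj (𝕜 := ℝ) i).hasFDerivAt.comp y hZ.hasFDerivAt
    simp only [pd, h1.fderiv]
    exact clm_eq_sum ((EuclideanSpace.proj (𝕜 := ℝ) i).comp (fderiv ℝ (chartVec p Z) y)) w
  rw [hb', Finset.sum_sub_distrib,
    ← hpd ((contDiffAt_chartVec hy hX).differentiableAt (by simp)),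
    ← hpd ((contDiffAt_chartVec hy hY).differentiableAt (by simp))]
  rfl

end

/-! ### The differential operators in a chart -/

section

variable {M : Type*} [TopologicalSpace M] [ChartedSpace E4 M]

/-- A function of `(x, λ)` in the chart at `p`. -/
def inChart (p : M) (f : M × ℂ → ℂ) (q : E4 × ℂ) : ℂ :=
  f ((extChartAt (𝓡 4) p).symm q.1, q.2)

lemma dLam_eq {p : M} {y : E4} {f : M × ℂ → ℂ} {z : ℂ}
    (hf : DifferentiableAt ℝ (inChart p f) (y, z)) :
    dLam f ((extChartAt (𝓡 4) p).symm y, z) = pdZ (inChart p f) (y, z) := by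
  have h1 : HasFDerivAt (fun z => f ((extChartAt (𝓡 4) p).symm y, z))
      ((fderiv ℝ (inChart p f) (y, z)).comp (ContinuousLinearMap.inr ℝ E4 ℂ)) z :=
    HasFDerivAt.comp (f := fun z => (y, z)) z hf.hasFDerivAt (hasFDerivAt_prodMk_right y z)
  rw [dLam, pdZ, cdir]
  simp only [h1.fderiv, ContinuousLinearMap.comp_apply, ContinuousLinearMap.inr_apply]
  have e1 : ((0 : E4), (1 / 2 : ℂ)) = (1 / 2 : ℝ) • ((0 : E4), (1 : ℂ)) := by
    ext <;> simp
  have e2 : ((0 : E4), -(Complex.I / 2)) = (-1 / 2 : ℝ) • ((0 : E4), Complex.I) := by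
    ext <;> simp
    ring
  rw [e1, e2, map_smul, map_smul, Complex.real_smul, Complex.real_smul]
  push_cast
  ring

variable [IsManifold (𝓡 4) ∞ M]

lemma comp_bracket {p : M} {y : E4} (hy : y ∈ (extChartAt (𝓡 4) p).target) {X Y : CVec M}
    {U : Set M} (hU : IsOpen U) (hyU : (extChartAt (𝓡 4) p).symm y ∈ U) (hX : X.SmoothOn U)
    (hY : Y.SmoothOn U) (i : Fin 4) :
    (X.bracket Y).comp p i y = ∑ j, (X.comp p j y * pdc j (Y.comp p i) y
      - Y.comp p j y * pdc j (X.comp p i) y) := by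
  have hat : ∀ {Z : (x : M) → TangentSpace (𝓡 4) x},
      ContMDiffOn (𝓡 4) (𝓡 4).tangent ∞ (fun x => (⟨x, Z x⟩ : TangentBundle (𝓡 4) M)) U →
      ContMDiffAt (𝓡 4) (𝓡 4).tangent ∞ (fun x => (⟨x, Z x⟩ : TangentBundle (𝓡 4) M))
        ((extChartAt (𝓡 4) p).symm y) := fun hZ => hZ.contMDiffAt (hU.mem_nhds hyU)
  have hd : ∀ {Z : (x : M) → TangentSpace (𝓡 4) x},
      ContMDiffOn (𝓡 4) (𝓡 4).tangent ∞ (fun x => (⟨x, Z x⟩ : TangentBundle (𝓡 4) M)) U →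
      DifferentiableAt ℝ (fun y => chartVec p Z y i) y := fun hZ =>
    ((EuclideanSpace.proj (𝕜 := ℝ) i).contDiff.contDiffAt.comp y
      (contDiffAt_chartVec hy (hat hZ))).differentiableAt (n := ∞) (by simp)
  have hc : ∀ {Z : CVec M}, Z.SmoothOn U → ∀ j, pdc j (Z.comp p i) y
      = pd j (fun y => chartVec p Z.re y i) y + Complex.I * pd j (fun y => chartVec p Z.im y i) y := by
    intro Z hZ j
    have hof : ∀ {f : E4 → ℝ}, DifferentiableAt ℝ f y →
        DifferentiableAt ℝ (fun y => (f y : ℂ)) y := fun hf =>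
      Complex.ofRealCLM.differentiableAt.comp y hf
    have h1 := hd hZ.1
    have h2 := hd hZ.2
    have e : Z.comp p i = fun y => (chartVec p Z.re y i : ℂ)
      + Complex.I * (chartVec p Z.im y i : ℂ) := rfl
    rw [e, pdc, cdir_add (hof h1) ((differentiableAt_const _).fun_mul (hof h2)),
      cdir_mul (differentiableAt_const _) (hof h2), cdir_const, ← pdc_ofReal j h1,
      ← pdc_ofReal j h2]
    simp [pdc]
  have hre : chartVec p (X.bracket Y).re y i
      = chartVec p (VectorField.mlieBracket (𝓡 4) X.re Y.re) y i
        - chartVec p (VectorField.mlieBracket (𝓡 4) X.im Y.im) y i := by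
    simp only [chartVec, CVec.bracket, map_sub]
    rfl
  have him : chartVec p (X.bracket Y).im y i
      = chartVec p (VectorField.mlieBracket (𝓡 4) X.re Y.im) y i
        + chartVec p (VectorField.mlieBracket (𝓡 4) X.im Y.re) y i := by
    simp only [chartVec, CVec.bracket, map_add]
    rfl
  rw [CVec.comp, hre, him, chartVec_mlieBracket hy (hat hX.1) (hat hY.1),
    chartVec_mlieBracket hy (hat hX.2) (hat hY.2), chartVec_mlieBracket hy (hat hX.1) (hat hY.2),
    chartVec_mlieBracket hy (hat hX.2) (hat hY.1)]
  simp only [hc hX, hc hY, CVec.comp]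
  push_cast
  rw [← Finset.sum_sub_distrib, ← Finset.sum_add_distrib, Finset.mul_sum,
    ← Finset.sum_add_distrib]
  refine Finset.sum_congr rfl fun j _ => ?_
  linear_combination (-(chartVec p X.im y j : ℂ) * pd j (fun y => chartVec p Y.im y i) y
    + (chartVec p Y.im y j : ℂ) * pd j (fun y => chartVec p X.im y i) y) * Complex.I_mul_I

lemma mvfderiv_coordVec {p : M} {y : E4} (hy : y ∈ (extChartAt (𝓡 4) p).target) {h : M → ℂ}
    (hh : DifferentiableAt ℝ (h ∘ (extChartAt (𝓡 4) p).symm) y) (i : Fin 4) :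
    mvfderiv (𝓡 4) h ((extChartAt (𝓡 4) p).symm y) (coordVec p y i)
      = pdc i (h ∘ (extChartAt (𝓡 4) p).symm) y := by
  have hs := (extChartAt (𝓡 4) p).map_target hy
  have hs' := hs
  rw [extChartAt_source] at hs'
  have hmd : MDifferentiableAt (𝓡 4) 𝓘(ℝ, ℂ) h ((extChartAt (𝓡 4) p).symm y) := by
    have h1 : MDifferentiableAt (𝓡 4) 𝓘(ℝ, ℂ)
        ((h ∘ (extChartAt (𝓡 4) p).symm) ∘ extChartAt (𝓡 4) p)
        ((extChartAt (𝓡 4) p).symm y) := by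
      refine MDifferentiableAt.comp (I' := 𝓘(ℝ, E4)) _ ?_ (mdifferentiableAt_extChartAt hs')
      rw [(extChartAt (𝓡 4) p).right_inv hy]
      exact hh.mdifferentiableAt
    refine h1.congr_of_eventuallyEq ?_
    filter_upwards [(isOpen_extChartAt_source p).mem_nhds hs] with x hx
    simp only [Function.comp_apply, (extChartAt (𝓡 4) p).left_inv hx]
  have h2 := mfderiv_comp_apply (I := 𝓘(ℝ, E4)) (I' := 𝓡 4) (I'' := 𝓘(ℝ, ℂ)) y hmd
    (mdifferentiableAt_extChartAt_symm hy) (EuclideanSpace.single i (1 : ℝ))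
  rw [pdc_apply]
  refine Eq.trans h2.symm ?_
  rw [mfderiv_eq_fderiv]
  rfl

lemma act_eq {p : M} {y : E4} (hy : y ∈ (extChartAt (𝓡 4) p).target) {f : M × ℂ → ℂ} {z : ℂ}
    (hf : DifferentiableAt ℝ (inChart p f) (y, z)) (X : CVec M) :
    X.act f ((extChartAt (𝓡 4) p).symm y, z)
      = ∑ i, X.comp p i y * pdX i (inChart p f) (y, z) := by
  have h1 : HasFDerivAt (fun y => inChart p f (y, z))
      ((fderiv ℝ (inChart p f) (y, z)).comp (ContinuousLinearMap.inl ℝ E4 ℂ)) y := by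
    exact HasFDerivAt.comp (f := fun y => (y, z)) y hf.hasFDerivAt (hasFDerivAt_prodMk_left y z)
  rw [CVec.act, pair_eq_sum hy]
  refine Finset.sum_congr rfl fun i _ => ?_
  have h2 := mvfderiv_coordVec (h := fun x => f (x, z)) hy h1.differentiableAt i
  rw [h2, pdc_apply, pdX_apply]
  change _ * fderiv ℝ (fun y => inChart p f (y, z)) y _ = _
  rw [h1.fderiv]
  simp

/-- The coordinates of the vector fields `eₐ`, as the columns of a matrix. -/
def frameMat (e : Fin 4 → CVec M) (p : M) (y : E4) : Matrix (Fin 4) (Fin 4) ℂ :=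
  Matrix.of fun i a => (e a).comp p i y

/-- The coordinates of the 1-forms `εₐ`, as the rows of a matrix. -/
def coframeMat (ε : Fin 4 → CForm M) (p : M) (y : E4) : Matrix (Fin 4) (Fin 4) ℂ :=
  Matrix.of fun a i => ε a ((extChartAt (𝓡 4) p).symm y) (coordVec p y i)

/-- The coordinates of the 1-form `A⁰ + λ A¹ + λ² A²`. -/
def formComp (A : Fin 3 → CForm M) (p : M) (i : Fin 4) (q : E4 × ℂ) : ℂ :=
  quadVal (fun k => A k ((extChartAt (𝓡 4) p).symm q.1) (coordVec p q.1 i)) q.2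

lemma opD_eq {p : M} {y : E4} (hy : y ∈ (extChartAt (𝓡 4) p).target) {f : M × ℂ → ℂ} {z : ℂ}
    (hf : DifferentiableAt ℝ (inChart p f) (y, z)) (e : Fin 4 → CVec M) (A : Fin 3 → CForm M)
    (a : Fin 4) :
    opD e A a f ((extChartAt (𝓡 4) p).symm y, z) = ∑ i, frameMat e p y i a *
      (pdX i (inChart p f) (y, z) + formComp A p i (y, z) * pdZ (inChart p f) (y, z)) := by
  rw [opD, act_eq hy hf, dLam_eq hf, pair_eq_sum hy, Finset.sum_mul, ← Finset.sum_add_distrib]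
  refine Finset.sum_congr rfl fun i _ => ?_
  have : quadForm A z ((extChartAt (𝓡 4) p).symm y) (coordVec p y i) = formComp A p i (y, z) := rfl
  simp only [this, frameMat, Matrix.of_apply]
  ring

lemma lax₁_eq {p : M} {y : E4} (hy : y ∈ (extChartAt (𝓡 4) p).target) {f : M × ℂ → ℂ} {z : ℂ}
    (hf : DifferentiableAt ℝ (inChart p f) (y, z)) (e : Fin 4 → CVec M) (A : Fin 3 → CForm M) :
    lax₁ e A f ((extChartAt (𝓡 4) p).symm y, z)
      = liftOp (fun i q => vecV (frameMat e p q.1) q.2 i) (formComp A p) (inChart p f) (y, z) := by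
  rw [lax₁, opD_eq hy hf, opD_eq hy hf, Finset.mul_sum, ← Finset.sum_add_distrib, liftOp]
  exact Finset.sum_congr rfl fun i _ => by simp only [vecV]; ring

lemma lax₂_eq {p : M} {y : E4} (hy : y ∈ (extChartAt (𝓡 4) p).target) {f : M × ℂ → ℂ} {z : ℂ}
    (hf : DifferentiableAt ℝ (inChart p f) (y, z)) (e : Fin 4 → CVec M) (A : Fin 3 → CForm M) :
    lax₂ e A f ((extChartAt (𝓡 4) p).symm y, z)
      = liftOp (fun i q => vecW (frameMat e p q.1) q.2 i) (formComp A p) (inChart p f) (y, z) := by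
  rw [lax₂, opD_eq hy hf, opD_eq hy hf, Finset.mul_sum, ← Finset.sum_sub_distrib, liftOp]
  exact Finset.sum_congr rfl fun i _ => by simp only [vecW]; ring

lemma contDiffAt_inChart {p : M} {y : E4} (hy : y ∈ (extChartAt (𝓡 4) p).target)
    {f : M × ℂ → ℂ} {z : ℂ}
    (hf : ContMDiffAt ((𝓡 4).prod 𝓘(ℝ, ℂ)) 𝓘(ℝ, ℂ) ∞ f ((extChartAt (𝓡 4) p).symm y, z)) :
    ContDiffAt ℝ ∞ (inChart p f) (y, z) := by
  have h1 : ContMDiffAt 𝓘(ℝ, E4 × ℂ) (𝓡 4) ∞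
      (fun q : E4 × ℂ => (extChartAt (𝓡 4) p).symm q.1) (y, z) := by
    have h2 : ContMDiffAt 𝓘(ℝ, E4) (𝓡 4) ∞ (extChartAt (𝓡 4) p).symm y :=
      (contMDiffOn_extChartAt_symm p).contMDiffAt (extChartAt_target_nhds hy)
    exact ContMDiffAt.comp (y, z) h2 contDiffAt_fst.contMDiffAt
  have h3 : ContMDiffAt 𝓘(ℝ, E4 × ℂ) 𝓘(ℝ, ℂ) ∞ (fun q : E4 × ℂ => q.2) (y, z) :=
    contDiffAt_snd.contMDiffAt
  exact (ContMDiffAt.comp (y, z) hf (h1.prodMk h3)).contDiffAt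

end

/-! ### Curvature of an anti-self-dual metric on the null planes -/

lemma sum_four_mul_outer_inner (a b c d : Fin 4 → ℂ) (X Y : Fin 4 → Fin 4 → ℂ) :
    ∑ i, ∑ j, ∑ k, ∑ l, a i * b j * c k * d l * (X i l * Y j k)
      = (∑ i, ∑ l, a i * d l * X i l) * ∑ j, ∑ k, b j * c k * Y j k := by
  rw [Finset.sum_mul]
  refine Finset.sum_congr rfl fun i _ => ?_
  rw [Finset.sum_mul]
  refine ((Finset.sum_congr rfl fun j _ => Finset.sum_comm).trans Finset.sum_comm).trans ?_
  refine Finset.sum_congr rfl fun l _ => ?_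
  simp only [Finset.mul_sum]
  exact Finset.sum_congr rfl fun j _ => Finset.sum_congr rfl fun k _ => by ring

lemma sum_four_comm (f : Fin 4 → Fin 4 → Fin 4 → Fin 4 → ℂ) :
    ∑ i, ∑ j, ∑ k, ∑ l, f i j k l = ∑ k, ∑ l, ∑ i, ∑ j, f i j k l := by
  calc ∑ i, ∑ j, ∑ k, ∑ l, f i j k l = ∑ i, ∑ k, ∑ l, ∑ j, f i j k l :=
        Finset.sum_congr rfl fun i _ => Finset.sum_comm.trans
          (Finset.sum_congr rfl fun k _ => Finset.sum_comm)
    _ = ∑ k, ∑ l, ∑ i, ∑ j, f i j k l :=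
        Finset.sum_comm.trans (Finset.sum_congr rfl fun k _ => Finset.sum_comm)

lemma vecV_eq_mulVec (E : Matrix (Fin 4) (Fin 4) ℂ) (z : ℂ) : vecV E z = E.mulVec (frameV z) := by
  ext i
  simp [vecV, frameV, Matrix.mulVec, dotProduct, Fin.sum_univ_succ]
  ring

lemma vecW_eq_mulVec (E : Matrix (Fin 4) (Fin 4) ℂ) (z : ℂ) : vecW E z = E.mulVec (frameW z) := by
  ext i
  simp [vecW, frameW, Matrix.mulVec, dotProduct, Fin.sum_univ_succ]
  ring

/-- The scalar product of two vectors given by their coordinates in a null frame. -/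
lemma sum_mulVec_mul_gram {E G : Matrix (Fin 4) (Fin 4) ℂ}
    (hG : E.transpose * G * E = nullGram) (u v : Fin 4 → ℂ) :
    ∑ i, ∑ j, E.mulVec u i * E.mulVec v j * G i j = dotProduct u (nullGram.mulVec v) := by
  have h : dotProduct (E.mulVec u) (G.mulVec (E.mulVec v)) = dotProduct u (nullGram.mulVec v) := by
    rw [← hG, ← Matrix.mulVec_mulVec, ← Matrix.mulVec_mulVec, Matrix.dotProduct_mulVec u,
      Matrix.vecMul_transpose]
  rw [← h]
  generalize E.mulVec v = v'
  simp only [dotProduct, Matrix.mulVec, Finset.mul_sum]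
  exact Finset.sum_congr rfl fun i _ => Finset.sum_congr rfl fun j _ => by ring

/-- A two-form `S` that annihilates the self-dual bivectors of the oriented orthonormal basis `B`
annihilates `V ∧ W`. -/
lemma sum_vecV_vecW_eq_zero {E Θ B G : Matrix (Fin 4) (Fin 4) ℂ} (hEΘ : E * Θ = 1)
    (hG : E.transpose * G * E = nullGram) (hB : B.transpose * G * B = 1)
    (hdet : (Θ * B).det = 1) (z : ℂ) {S : Fin 4 → Fin 4 → ℂ} (hS : ∀ i j, S i j = -S j i)
    (h : ∀ σ : Equiv.Perm (Fin 4), Equiv.Perm.sign σ = 1 →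
      ∑ i, ∑ j, B i (σ 0) * B j (σ 1) * S i j + ∑ i, ∑ j, B i (σ 2) * B j (σ 3) * S i j = 0) :
    ∑ i, ∑ j, vecV E z i * vecW E z j * S i j = 0 := by
  have hPE : E * (Θ * B) = B := by rw [← Matrix.mul_assoc, hEΘ, Matrix.one_mul]
  have hP : (Θ * B).transpose * nullGram * (Θ * B) = 1 := by
    calc (Θ * B).transpose * nullGram * (Θ * B)
        = (E * (Θ * B)).transpose * G * (E * (Θ * B)) := by
          rw [← hG, Matrix.transpose_mul E]
          simp only [Matrix.mul_assoc]
      _ = 1 := by rw [hPE, hB]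
  have hsol : ∀ u, (Θ * B).mulVec ((Θ * B)⁻¹.mulVec u) = u := fun u => by
    rw [Matrix.mulVec_mulVec, Matrix.mul_nonsing_inv _ (by rw [hdet]; exact isUnit_one),
      Matrix.one_mulVec]
  have hE : ∀ u, E.mulVec u = B.mulVec ((Θ * B)⁻¹.mulVec u) := fun u => by
    conv_lhs => rw [← hsol u, Matrix.mulVec_mulVec, hPE]
  -- the components of `S` in the basis `B`; besides the given order of the basis, its two cyclic
  -- permutations with fixed `b₀` yield the three conditions of `selfDual_contraction`
  let T : Fin 4 → Fin 4 → ℂ := fun a c => ∑ i, ∑ j, B i a * B j c * S i j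
  have hT : ∀ a c, T a c = -T c a := by
    intro a c
    simp only [T]
    rw [Finset.sum_comm, ← Finset.sum_neg_distrib]
    refine Finset.sum_congr rfl fun i _ => ?_
    rw [← Finset.sum_neg_distrib]
    refine Finset.sum_congr rfl fun j _ => ?_
    rw [hS j i]
    ring
  have hp : ∀ σ : Equiv.Perm (Fin 4), Equiv.Perm.sign σ = 1 →
      T (σ 0) (σ 1) + T (σ 2) (σ 3) = 0 := h
  have h1 : T 0 1 + T 2 3 = 0 := hp 1 (by simp)
  have h2 : T 0 2 + T 3 1 = 0 := by
    have := hp (Equiv.swap 1 2 * Equiv.swap 2 3) (by decide)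
    rwa [show (Equiv.swap 1 2 * Equiv.swap 2 3 : Equiv.Perm (Fin 4)) 0 = 0 by decide,
      show (Equiv.swap 1 2 * Equiv.swap 2 3 : Equiv.Perm (Fin 4)) 1 = 2 by decide,
      show (Equiv.swap 1 2 * Equiv.swap 2 3 : Equiv.Perm (Fin 4)) 2 = 3 by decide,
      show (Equiv.swap 1 2 * Equiv.swap 2 3 : Equiv.Perm (Fin 4)) 3 = 1 by decide] at this
  have h3 : T 0 3 + T 1 2 = 0 := by
    have := hp (Equiv.swap 2 3 * Equiv.swap 1 2) (by decide)
    rwa [show (Equiv.swap 2 3 * Equiv.swap 1 2 : Equiv.Perm (Fin 4)) 0 = 0 by decide,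
      show (Equiv.swap 2 3 * Equiv.swap 1 2 : Equiv.Perm (Fin 4)) 1 = 3 by decide,
      show (Equiv.swap 2 3 * Equiv.swap 1 2 : Equiv.Perm (Fin 4)) 2 = 1 by decide,
      show (Equiv.swap 2 3 * Equiv.swap 1 2 : Equiv.Perm (Fin 4)) 3 = 2 by decide] at this
  have hz := selfDual_contraction hP hdet (hsol (frameV z)) (hsol (frameW z)) hT h1 h2 h3
  rw [← hz, vecV_eq_mulVec, vecW_eq_mulVec, hE, hE]
  generalize (Θ * B)⁻¹.mulVec (frameV z) = u
  generalize (Θ * B)⁻¹.mulVec (frameW z) = w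
  calc ∑ i, ∑ j, B.mulVec u i * B.mulVec w j * S i j
      = ∑ i, ∑ j, ∑ a, ∑ c, u a * w c * (B i a * B j c * S i j) := by
        refine Finset.sum_congr rfl fun i _ => Finset.sum_congr rfl fun j _ => ?_
        rw [Matrix.mulVec, Matrix.mulVec, dotProduct, dotProduct, Finset.sum_mul_sum,
          Finset.sum_mul]
        refine Finset.sum_congr rfl fun a _ => ?_
        rw [Finset.sum_mul]
        exact Finset.sum_congr rfl fun c _ => by ring
    _ = _ := by
        rw [sum_four_comm]
        simp only [T, Finset.mul_sum]

section

variable {M : Type*} [TopologicalSpace M] [ChartedSpace E4 M] [IsManifold (𝓡 4) ∞ M]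

/-- The coordinates of a tangent vector at `x` in the chart at `p`. -/
def vcoord (p x : M) (v : TangentSpace (𝓡 4) x) : E4 :=
  mfderiv (𝓡 4) 𝓘(ℝ, E4) (extChartAt (𝓡 4) p) x v

lemma vec_eq_sum {p : M} {y : E4} (hy : y ∈ (extChartAt (𝓡 4) p).target)
    (v : TangentSpace (𝓡 4) ((extChartAt (𝓡 4) p).symm y)) :
    v = ∑ i, vcoord p _ v i • coordVec p y i :=
  (mfderiv_extChartAt_symm_comp hy v).symm.trans
    (clm_eq_sum (mfderiv 𝓘(ℝ, E4) (𝓡 4) (extChartAt (𝓡 4) p).symm y) (vcoord p _ v))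

lemma inner_eq_sum {p x : M} {y : E4} (hy : y ∈ (extChartAt (𝓡 4) p).target)
    (hx : (extChartAt (𝓡 4) p).symm y = x) (g : RMetric M) (v w : TangentSpace (𝓡 4) x) :
    g.inner x v w = ∑ i, ∑ j, vcoord p x v i * vcoord p x w j * gram g p y i j := by
  subst hx
  conv_lhs => rw [vec_eq_sum hy v, vec_eq_sum hy w]
  simp only [map_sum, map_smul, sum_apply, smul_apply, smul_eq_mul,
    Finset.mul_sum]
  rw [Finset.sum_comm]
  refine Finset.sum_congr rfl fun i _ => Finset.sum_congr rfl fun j _ => ?_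
  simp only [gram, Matrix.of_apply]
  ring

lemma form_eq_sum {p x : M} {y : E4} (hy : y ∈ (extChartAt (𝓡 4) p).target)
    (hx : (extChartAt (𝓡 4) p).symm y = x) (ξ : CForm M) (v : TangentSpace (𝓡 4) x) :
    ξ x v = ∑ i, ξ ((extChartAt (𝓡 4) p).symm y) (coordVec p y i) * (vcoord p x v i : ℂ) := by
  subst hx
  conv_lhs => rw [vec_eq_sum hy v]
  rw [map_sum]
  refine Finset.sum_congr rfl fun i _ => ?_
  rw [map_smul, Complex.real_smul, mul_comm]

lemma exists_vcoord_eq {p x : M} {y : E4} (hy : y ∈ (extChartAt (𝓡 4) p).target)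
    (hx : (extChartAt (𝓡 4) p).symm y = x) (w : E4) :
    ∃ v : TangentSpace (𝓡 4) x, vcoord p x v = w := by
  subst hx
  exact ⟨_, mfderiv_extChartAt_comp_symm hy w⟩

/-- The condition `W⁺ = 0` in coordinates. -/
lemma WeylPlusVanishes.sum_weylComp {o : ManifoldOrientation M} {g : RMetric M}
    (hW : WeylPlusVanishes o g) {p : M} {b : Module.Basis (Fin 4) ℝ (TangentSpace (𝓡 4) p)}
    (hb : IsOrientedOrthonormal o g p b) (σ : Equiv.Perm (Fin 4)) (hσ : Equiv.Perm.sign σ = 1)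
    (k l : Fin 4) :
    ∑ i, ∑ j, vcoord p p (b (σ 0)) i * vcoord p p (b (σ 1)) j *
        weylComp g p i j k l (extChartAt (𝓡 4) p p)
      + ∑ i, ∑ j, vcoord p p (b (σ 2)) i * vcoord p p (b (σ 3)) j *
        weylComp g p i j k l (extChartAt (𝓡 4) p p) = 0 := by
  have hy := mem_extChartAt_target (I := 𝓡 4) p
  have hx := extChartAt_to_inv (I := 𝓡 4) p
  -- the last two arguments of the Weyl tensor are `∂ₖ` and `∂ₗ`
  obtain ⟨v, hv⟩ := exists_vcoord_eq hy hx (EuclideanSpace.single k 1)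
  obtain ⟨w, hw⟩ := exists_vcoord_eq hy hx (EuclideanSpace.single l 1)
  have key : ∀ v₁ v₂, weyl g p v₁ v₂ v w = ∑ i, ∑ j, vcoord p p v₁ i * vcoord p p v₂ j *
      weylComp g p i j k l (extChartAt (𝓡 4) p p) := by
    intro v₁ v₂
    have h1 : ∀ u : TangentSpace (𝓡 4) p, coords p u = vcoord p p u := fun u => rfl
    simp only [weyl, h1, hv, hw]
    refine Finset.sum_congr rfl fun i _ => Finset.sum_congr rfl fun j _ => ?_
    rw [Finset.sum_eq_single k _ (by simp), Finset.sum_eq_single l _ (by simp)]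
    · simp
    · intro c _ hc
      simp [hc]
    · intro c _ hc
      simp [hc]
  have h := hW p _ (hb.perm σ hσ) v w
  rw [key, key] at h
  simpa using h

lemma weylComp_antisymm (g : RMetric M) (p : M) (i j k l : Fin 4) (y : E4) :
    weylComp g p i j k l y = -weylComp g p j i k l y := by
  have h : ∀ m, riemannUp g p m k i j y = -riemannUp g p m k j i y := by
    intro m
    simp only [riemannUp, Finset.sum_sub_distrib]
    ring
  have h2 : riemann g p i j k l y = -riemann g p j i k l y := by
    simp only [riemann, h, mul_neg, Finset.sum_neg_distrib]
  simp only [weylComp, h2]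
  ring

/-- The curvature of a metric with `W⁺ = 0` vanishes on the planes spanned by `V = e₃ + λ e₁` and
`W = e₀ - λ e₂`, `R(V, W, V, W) = 0`: the Ricci part drops out because the planes are totally
null, and the Weyl part because `V ∧ W` is self-dual. -/
lemma WeylPlusVanishes.sum_riemann {o : ManifoldOrientation M} {g : RMetric M}
    (hW : WeylPlusVanishes o g) {p : M} {E Θ : Matrix (Fin 4) (Fin 4) ℂ} (hEΘ : E * Θ = 1)
    (hG : E.transpose * gramC g p (extChartAt (𝓡 4) p p) * E = nullGram)
    (hdet : ∀ b : Module.Basis (Fin 4) ℝ (TangentSpace (𝓡 4) p), IsOrientedOrthonormal o g p b →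
      (Θ * Matrix.of fun i a => (vcoord p p (b a) i : ℂ)).det = 1) (z : ℂ) :
    ∑ i, ∑ j, ∑ k, ∑ l, vecV E z i * vecW E z j * vecV E z k * vecW E z l *
      (riemann g p i j k l (extChartAt (𝓡 4) p p) : ℂ) = 0 := by
  have hy := mem_extChartAt_target (I := 𝓡 4) p
  have hx := extChartAt_to_inv (I := 𝓡 4) p
  set y := extChartAt (𝓡 4) p p with hydef
  obtain ⟨b, hb⟩ := exists_orientedOrthonormal o g p
  set B : Matrix (Fin 4) (Fin 4) ℂ := Matrix.of fun i a => (vcoord p p (b a) i : ℂ) with hB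
  have hBG : B.transpose * gramC g p y * B = 1 := by
    ext a c
    have h' : ((g.inner p (b a) (b c) : ℝ) : ℂ) = ((∑ i, ∑ j, vcoord p p (b a) i *
      vcoord p p (b c) j * gram g p y i j : ℝ) : ℂ) := congrArg _ (inner_eq_sum hy hx g (b a) (b c))
    rw [hb.2] at h'
    have e : (B.transpose * gramC g p y * B) a c = ∑ i, ∑ j, B i a * B j c * gramC g p y i j := by
      simp only [Matrix.mul_apply, Matrix.transpose_apply, Finset.sum_mul]
      rw [Finset.sum_comm]
      exact Finset.sum_congr rfl fun i _ => Finset.sum_congr rfl fun j _ => by ring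
    rw [e, Matrix.one_apply]
    push_cast at h'
    refine h'.symm.trans ?_
    split_ifs <;> simp
  have hweyl : ∀ k l, ∑ i, ∑ j, vecV E z i * vecW E z j * (weylComp g p i j k l y : ℂ) = 0 := by
    intro k l
    refine sum_vecV_vecW_eq_zero hEΘ hG hBG (hdet b hb) z (fun i j => ?_) fun σ hσ => ?_
    · rw [weylComp_antisymm]
      push_cast
      ring
    · have h := congrArg (fun r : ℝ => (r : ℂ)) (hW.sum_weylComp hb σ hσ k l)
      push_cast at h
      exact h
  have hg : ∀ i j, gramC g p y i j = (gram g p y i j : ℂ) := fun i j => rfl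
  have hVV : ∑ i, ∑ j, vecV E z i * vecV E z j * (gram g p y i j : ℂ) = 0 := by
    simp only [← hg]
    rw [vecV_eq_mulVec, sum_mulVec_mul_gram hG]
    simp [frameV, nullGram, dotProduct, Matrix.mulVec, Fin.sum_univ_succ]
  have hWW : ∑ i, ∑ j, vecW E z i * vecW E z j * (gram g p y i j : ℂ) = 0 := by
    simp only [← hg]
    rw [vecW_eq_mulVec, sum_mulVec_mul_gram hG]
    simp [frameW, nullGram, dotProduct, Matrix.mulVec, Fin.sum_univ_succ]
  have hVW : ∑ i, ∑ j, vecV E z i * vecW E z j * (gram g p y i j : ℂ) = 0 := by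
    simp only [← hg]
    rw [vecV_eq_mulVec, vecW_eq_mulVec, sum_mulVec_mul_gram hG]
    simp [frameV, frameW, nullGram, dotProduct, Matrix.mulVec, Fin.sum_univ_succ]
  have hWV : ∑ i, ∑ j, vecW E z i * vecV E z j * (gram g p y i j : ℂ) = 0 := by
    simp only [← hg]
    rw [vecV_eq_mulVec, vecW_eq_mulVec, sum_mulVec_mul_gram hG]
    simp [frameV, frameW, nullGram, dotProduct, Matrix.mulVec, Fin.sum_univ_succ]
  have hR : ∀ i j k l, (riemann g p i j k l y : ℂ) = weylComp g p i j k l y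
      + 1 / 2 * (gram g p y i l * ricci g p j k y) - 1 / 2 * (gram g p y i k * ricci g p j l y)
      + 1 / 2 * (ricci g p i l y * gram g p y j k) - 1 / 2 * (ricci g p i k y * gram g p y j l)
      - scalar g p y / 6 * (gram g p y i l * gram g p y j k)
      + scalar g p y / 6 * (gram g p y i k * gram g p y j l) := by
    intro i j k l
    rw [weylComp]
    push_cast
    ring
  have hWe : ∑ i, ∑ j, ∑ k, ∑ l, vecV E z i * vecW E z j * vecV E z k * vecW E z l *
      (weylComp g p i j k l y : ℂ) = 0 := by
    rw [sum_four_comm]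
    refine Finset.sum_eq_zero fun k _ => Finset.sum_eq_zero fun l _ => ?_
    rw [← mul_zero (vecV E z k * vecW E z l), ← hweyl k l, Finset.mul_sum]
    refine Finset.sum_congr rfl fun i _ => ?_
    rw [Finset.mul_sum]
    exact Finset.sum_congr rfl fun j _ => by ring
  have hout : ∀ X Y : Fin 4 → Fin 4 → ℂ,
      (∑ i, ∑ l, vecV E z i * vecW E z l * X i l = 0 ∨
        ∑ j, ∑ k, vecW E z j * vecV E z k * Y j k = 0) → ∀ r : ℂ,
      ∑ i, ∑ j, ∑ k, ∑ l, vecV E z i * vecW E z j * vecV E z k * vecW E z l *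
        (r * (X i l * Y j k)) = 0 := by
    intro X Y h r
    rw [← mul_zero r, ← mul_eq_zero.mpr h, ← sum_four_mul_outer_inner]
    simp only [Finset.mul_sum]
    exact Finset.sum_congr rfl fun i _ => Finset.sum_congr rfl fun j _ =>
      Finset.sum_congr rfl fun k _ => Finset.sum_congr rfl fun l _ => by ring
  have hin : ∀ X Y : Fin 4 → Fin 4 → ℂ,
      (∑ i, ∑ k, vecV E z i * vecV E z k * X i k = 0 ∨
        ∑ j, ∑ l, vecW E z j * vecW E z l * Y j l = 0) → ∀ r : ℂ,
      ∑ i, ∑ j, ∑ k, ∑ l, vecV E z i * vecW E z j * vecV E z k * vecW E z l *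
        (r * (X i k * Y j l)) = 0 := by
    intro X Y h r
    rw [← mul_zero r, ← mul_eq_zero.mpr h, ← sum_four_mul_outer_inner]
    simp only [Finset.mul_sum]
    exact Finset.sum_congr rfl fun i _ => Finset.sum_congr rfl fun j _ =>
      Finset.sum_comm.trans (Finset.sum_congr rfl fun k _ => Finset.sum_congr rfl fun l _ => by ring)
  simp only [hR, mul_add, mul_sub, Finset.sum_add_distrib, Finset.sum_sub_distrib]
  rw [hWe, hout (fun i l => gram g p y i l) (fun j k => ricci g p j k y) (Or.inl hVW),
    hin (fun i k => gram g p y i k) (fun j l => ricci g p j l y) (Or.inl hVV),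
    hout (fun i l => ricci g p i l y) (fun j k => gram g p y j k) (Or.inr hWV),
    hin (fun i k => ricci g p i k y) (fun j l => gram g p y j l) (Or.inr hWW),
    hout (fun i l => gram g p y i l) (fun j k => gram g p y j k) (Or.inl hVW),
    hin (fun i k => gram g p y i k) (fun j l => gram g p y j l) (Or.inl hVV)]
  ring

end

/-! ### Null tetrads in a chart -/

lemma contDiffAt_structFun {E Θ : E4 → Matrix (Fin 4) (Fin 4) ℂ} {y : E4} (hE : SmoothMat E y)
    (hΘ : SmoothMat Θ y) (a b c : Fin 4) : ContDiffAt ℝ ∞ (fun y => structFun E Θ y a b c) y := by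
  have hpd : ∀ i k a, ContDiffAt ℝ ∞ (fun y => pdc i (fun z => E z k a) y) y := fun i k a =>
    hE.pdM i k a
  exact ContDiffAt.sum fun k _ => (hΘ c k).mul (ContDiffAt.sum fun i _ =>
    ((hE i a).mul (hpd i k b)).sub ((hE i b).mul (hpd i k a)))

section

variable {M : Type*} [TopologicalSpace M] [ChartedSpace E4 M]

lemma eventually_mem_chart {U : Set M} (hU : IsOpen U) {p : M} (hp : p ∈ U) :
    ∀ᶠ y in 𝓝 (extChartAt (𝓡 4) p p), y ∈ (extChartAt (𝓡 4) p).target ∧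
      (extChartAt (𝓡 4) p).symm y ∈ U := by
  refine Filter.Eventually.and (extChartAt_target_nhds (mem_extChartAt_target p)) ?_
  refine (continuousAt_extChartAt_symm (I := 𝓡 4) p).eventually ?_
  rw [extChartAt_to_inv]
  exact hU.mem_nhds hp

/-- Smoothness of a function on `U` can be checked at every point in the chart at that point. -/
lemma contMDiffOn_of_chart {U : Set M} {h : M → ℂ}
    (hh : ∀ p ∈ U, ContDiffAt ℝ ∞ (h ∘ (extChartAt (𝓡 4) p).symm) (extChartAt (𝓡 4) p p)) :
    ContMDiffOn (𝓡 4) 𝓘(ℝ, ℂ) ∞ h U := by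
  intro p hp
  refine ContMDiffAt.contMDiffWithinAt ?_
  have h1 : ContMDiffAt (𝓡 4) 𝓘(ℝ, ℂ) ∞
      ((h ∘ (extChartAt (𝓡 4) p).symm) ∘ extChartAt (𝓡 4) p) p :=
    (hh p hp).contMDiffAt.comp p contMDiffAt_extChartAt
  refine h1.congr_of_eventuallyEq ?_
  filter_upwards [extChartAt_source_mem_nhds (I := 𝓡 4) p] with x hx
  simp only [Function.comp_apply, (extChartAt (𝓡 4) p).left_inv hx]

variable [IsManifold (𝓡 4) ∞ M]

/-- In the trivialization of the bundle `Hom(TM, ℂ)` at `p`, the components of a form are its values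
on the coordinate vector fields of the chart at `p`. -/
lemma inCoordinates_single {p : M} {y : E4} (hy : y ∈ (extChartAt (𝓡 4) p).target) (ξ : CForm M)
    (i : Fin 4) :
    ContinuousLinearMap.inCoordinates E4 (TangentSpace (𝓡 4)) ℂ (Bundle.Trivial M ℂ) p
      ((extChartAt (𝓡 4) p).symm y) p ((extChartAt (𝓡 4) p).symm y)
      (ξ ((extChartAt (𝓡 4) p).symm y)) (EuclideanSpace.single i (1 : ℝ))
      = ξ ((extChartAt (𝓡 4) p).symm y) (coordVec p y i) := by
  have hs := (extChartAt (𝓡 4) p).map_target hy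
  rw [extChartAt_source] at hs
  have h1 := TangentBundle.symmL_trivializationAt (I := 𝓡 4) hs
  rw [ModelWithCorners.range_eq_univ, mfderivWithin_univ] at h1
  have h2 : ∀ z, z = y → @Eq E4
      (mfderiv 𝓘(ℝ, E4) (𝓡 4) (extChartAt (𝓡 4) p).symm z (EuclideanSpace.single i (1 : ℝ)))
      (coordVec p y i) := by
    rintro z rfl
    rfl
  have h3 := (DFunLike.congr_fun h1 (EuclideanSpace.single i (1 : ℝ))).trans
    (h2 _ ((extChartAt (𝓡 4) p).right_inv hy))
  simp only [ContinuousLinearMap.inCoordinates, ContinuousLinearMap.comp_apply]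
  rw [h3]
  simp

/-- A complex 1-form is smooth at `p` if and only if its components in the chart at `p` are. -/
lemma contMDiffAt_form_iff (ξ : CForm M) (p : M) :
    ContMDiffAt (𝓡 4) ((𝓡 4).prod 𝓘(ℝ, E4 →L[ℝ] ℂ)) ∞
      (fun x => Bundle.TotalSpace.mk' (E4 →L[ℝ] ℂ)
        (E := fun x : M => (TangentSpace (𝓡 4) x →L[ℝ] Bundle.Trivial M ℂ x)) x (ξ x)) p ↔
    ∀ i, ContDiffAt ℝ ∞ (fun y => ξ ((extChartAt (𝓡 4) p).symm y) (coordVec p y i))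
      (extChartAt (𝓡 4) p p) := by
  have hy := mem_extChartAt_target (I := 𝓡 4) p
  have hx := extChartAt_to_inv (I := 𝓡 4) p
  rw [contMDiffAt_hom_bundle]
  set F : M → (E4 →L[ℝ] ℂ) := fun x => ContinuousLinearMap.inCoordinates E4
    (TangentSpace (𝓡 4)) ℂ (Bundle.Trivial M ℂ) p x p x (ξ x) with hF
  have hev : ∀ i, (fun y => F ((extChartAt (𝓡 4) p).symm y) (EuclideanSpace.single i (1 : ℝ)))
      =ᶠ[𝓝 (extChartAt (𝓡 4) p p)]
      fun y => ξ ((extChartAt (𝓡 4) p).symm y) (coordVec p y i) := fun i => by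
    filter_upwards [extChartAt_target_nhds hy] with z hz using inCoordinates_single hz ξ i
  have h2 : ContMDiffAt 𝓘(ℝ, E4) (𝓡 4) ∞ (extChartAt (𝓡 4) p).symm (extChartAt (𝓡 4) p p) :=
    (contMDiffOn_extChartAt_symm p).contMDiffAt (extChartAt_target_nhds hy)
  constructor
  · rintro ⟨-, h⟩ i
    have h3 : ContMDiffAt (𝓡 4) 𝓘(ℝ, E4 →L[ℝ] ℂ) ∞ F ((extChartAt (𝓡 4) p).symm
      (extChartAt (𝓡 4) p p)) := by rw [hx]; exact h
    have h4 := (h3.comp _ h2).contDiffAt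
    exact (h4.clm_apply contDiffAt_const).congr_of_eventuallyEq (hev i).symm
  · intro h
    refine ⟨contMDiffAt_id, ?_⟩
    have h5 : ContDiffAt ℝ ∞ (F ∘ (extChartAt (𝓡 4) p).symm) (extChartAt (𝓡 4) p p) := by
      have h6 : F ∘ (extChartAt (𝓡 4) p).symm = fun y => ∑ i,
          (EuclideanSpace.proj (𝕜 := ℝ) i : E4 →L[ℝ] ℝ).smulRight
            (F ((extChartAt (𝓡 4) p).symm y) (EuclideanSpace.single i (1 : ℝ))) := by
        ext y w
        rw [Function.comp_apply, clm_eq_sum, sum_apply]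
        rfl
      rw [h6]
      refine ContDiffAt.sum fun i _ => ?_
      exact (ContinuousLinearMap.smulRightL ℝ E4 ℂ
        (EuclideanSpace.proj (𝕜 := ℝ) i)).contDiff.contDiffAt.comp _
          ((h i).congr_of_eventuallyEq (hev i))
    have h1 : ContMDiffAt (𝓡 4) 𝓘(ℝ, E4 →L[ℝ] ℂ) ∞
        ((F ∘ (extChartAt (𝓡 4) p).symm) ∘ extChartAt (𝓡 4) p) p :=
      h5.contMDiffAt.comp p contMDiffAt_extChartAt
    refine h1.congr_of_eventuallyEq ?_
    filter_upwards [extChartAt_source_mem_nhds (I := 𝓡 4) p] with x hx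
    simp only [Function.comp_apply, (extChartAt (𝓡 4) p).left_inv hx]

/-- The functions `⟨εᶜ, [eₐ, e_b]⟩`. -/
def bracketCoeff (ε : Fin 4 → CForm M) (e : Fin 4 → CVec M) (x : M) (a b c : Fin 4) : ℂ :=
  pair x (ε c x) ((e a).bracket (e b))

namespace IsNullTetrad

variable {o : ManifoldOrientation M} {g : RMetric M} {U : Set M} {ε : Fin 4 → CForm M}
  {e : Fin 4 → CVec M}

lemma bracketCoeff_eq (h : IsNullTetrad o g U ε e) (hU : IsOpen U) {p : M} {y : E4}
    (hy : y ∈ (extChartAt (𝓡 4) p).target) (hyU : (extChartAt (𝓡 4) p).symm y ∈ U) :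
    bracketCoeff ε e ((extChartAt (𝓡 4) p).symm y)
      = structFun (frameMat e p) (coframeMat ε p) y := by
  ext a b c
  rw [bracketCoeff, pair_eq_sum hy, structFun]
  refine Finset.sum_congr rfl fun k _ => ?_
  rw [comp_bracket hy hU hyU (h.smooth_vec a) (h.smooth_vec b), mul_comm]
  rfl

lemma coframeMat_mul_frameMat (h : IsNullTetrad o g U ε e) {p : M} {y : E4}
    (hy : y ∈ (extChartAt (𝓡 4) p).target) (hyU : (extChartAt (𝓡 4) p).symm y ∈ U) :
    coframeMat ε p y * frameMat e p y = 1 := by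
  ext c a
  rw [Matrix.one_apply, ← h.dual _ hyU, pair_eq_sum hy, Matrix.mul_apply]
  exact Finset.sum_congr rfl fun i _ => mul_comm _ _

lemma gramC_eq (h : IsNullTetrad o g U ε e) {p : M} {y : E4}
    (hyU : (extChartAt (𝓡 4) p).symm y ∈ U) :
    gramC g p y = (coframeMat ε p y).transpose * nullGram * coframeMat ε p y := by
  ext i j
  have h1 : gramC g p y i j = _ := h.metric_eq _ hyU (coordVec p y i) (coordVec p y j)
  rw [h1]
  simp [Matrix.mul_apply, Fin.sum_univ_four, nullGram, coframeMat]
  ring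

lemma smoothMat_frameMat (h : IsNullTetrad o g U ε e) (hU : IsOpen U) {p : M} (hp : p ∈ U) :
    SmoothMat (frameMat e p) (extChartAt (𝓡 4) p p) := fun i a =>
  contDiffAt_comp (mem_extChartAt_target p) hU (by rwa [extChartAt_to_inv]) (h.smooth_vec a) i

lemma smoothMat_coframeMat (h : IsNullTetrad o g U ε e) (hU : IsOpen U) {p : M} (hp : p ∈ U) :
    SmoothMat (coframeMat ε p) (extChartAt (𝓡 4) p p) := fun a i =>
  (contMDiffAt_form_iff (ε a) p).mp ((h.smooth_form a).contMDiffAt (hU.mem_nhds hp)) i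

lemma frame_gram (h : IsNullTetrad o g U ε e) {p : M} {y : E4}
    (hy : y ∈ (extChartAt (𝓡 4) p).target) (hyU : (extChartAt (𝓡 4) p).symm y ∈ U) :
    (frameMat e p y).transpose * gramC g p y * frameMat e p y = nullGram := by
  have h1 := h.coframeMat_mul_frameMat hy hyU
  calc (frameMat e p y).transpose * gramC g p y * frameMat e p y
      = (coframeMat ε p y * frameMat e p y).transpose * nullGram
        * (coframeMat ε p y * frameMat e p y) := by
        rw [h.gramC_eq hyU, Matrix.transpose_mul]
        simp only [Matrix.mul_assoc]
    _ = nullGram := by rw [h1, Matrix.transpose_one, Matrix.one_mul, Matrix.mul_one]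

lemma isNullFrame (h : IsNullTetrad o g U ε e) (hU : IsOpen U) {p : M} (hp : p ∈ U) :
    IsNullFrame (gramC g p) (conn g p) (frameMat e p) (coframeMat ε p) (extChartAt (𝓡 4) p p) ∧
      (∀ i j k, DifferentiableAt ℝ (christoffel g p k i j) (extChartAt (𝓡 4) p p)) :=
  isNullFrame_of_gram (h.smoothMat_frameMat hU hp) (h.smoothMat_coframeMat hU hp)
    ((eventually_mem_chart hU hp).mono fun _ hy =>
      mul_eq_one_comm.mp (h.coframeMat_mul_frameMat hy.1 hy.2))
    ((eventually_mem_chart hU hp).mono fun _ hy => h.frame_gram hy.1 hy.2)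

/-- The curvature hypothesis of `IsNullFrame.lax_commutator` for a metric with `W⁺ = 0`. -/
lemma sum_curvM (h : IsNullTetrad o g U ε e) (hW : WeylPlusVanishes o g) (hU : IsOpen U) {p : M}
    (hp : p ∈ U) (z : ℂ) :
    ∑ i, ∑ j, ∑ k, ∑ l, vecV (frameMat e p (extChartAt (𝓡 4) p p)) z i
      * vecW (frameMat e p (extChartAt (𝓡 4) p p)) z j
      * vecV (frameMat e p (extChartAt (𝓡 4) p p)) z k
      * vecW (frameMat e p (extChartAt (𝓡 4) p p)) z l
      * (gramC g p (extChartAt (𝓡 4) p p) * curvM (conn g p) i j (extChartAt (𝓡 4) p p)) l k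
      = 0 := by
  have hy := mem_extChartAt_target (I := 𝓡 4) p
  have hx := extChartAt_to_inv (I := 𝓡 4) p
  have hyU : (extChartAt (𝓡 4) p).symm (extChartAt (𝓡 4) p p) ∈ U := by rwa [hx]
  simp only [gramC_mul_curvM (h.isNullFrame hU hp).2]
  refine hW.sum_riemann (mul_eq_one_comm.mp (h.coframeMat_mul_frameMat hy hyU))
    (h.frame_gram hy hyU) (fun b hb => ?_) z
  rw [← h.volume_eq p hp b hb]
  congr 1
  ext a c
  rw [Matrix.of_apply, form_eq_sum hy hx, Matrix.mul_apply]
  rfl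

end IsNullTetrad

end

/-! ### Conformal change and the 1-form `A` -/

lemma contDiffAt_twistorCoeff {C : E4 → Fin 4 → Fin 4 → Fin 4 → ℂ} {y : E4}
    (hC : ∀ a b c, ContDiffAt ℝ ∞ (fun y => C y a b c) y) (k : Fin 3) (a : Fin 4) :
    ContDiffAt ℝ ∞ (fun y => twistorCoeff (C y) k a) y := by
  have hk : ∀ a b c, ContDiffAt ℝ ∞ (fun y => koszul (C y) a b c) y := fun a b c =>
    (((hC _ _ _).sub (hC _ _ _)).sub (hC _ _ _)).div_const 2
  fin_cases k
  · exact (hk a 3 0).neg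
  · exact (hk a 3 2).sub (hk a 1 0)
  · exact hk a 1 2

lemma differentiableAt_liftOp {V A : Fin 4 → E4 × ℂ → ℂ} {F : E4 × ℂ → ℂ} {q : E4 × ℂ}
    (hV : ∀ i, DifferentiableAt ℝ (V i) q) (hA : ∀ i, DifferentiableAt ℝ (A i) q)
    (hF : ContDiffAt ℝ ∞ F q) : DifferentiableAt ℝ (liftOp V A F) q := by
  have hX : ∀ i, DifferentiableAt ℝ (pdX i F) q := fun i =>
    (cdir_contDiffAt _ _ hF).differentiableAt (by simp)
  have hZ : DifferentiableAt ℝ (pdZ F) q := (cdir_contDiffAt _ _ hF).differentiableAt (by simp)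
  exact DifferentiableAt.fun_sum fun i _ => (hV i).fun_mul ((hX i).fun_add ((hA i).fun_mul hZ))

section

variable {M : Type*} [TopologicalSpace M] [ChartedSpace E4 M]

/-- The product of a real function and a complex vector field. -/
def CVec.scale (s : M → ℝ) (X : CVec M) : CVec M where
  re x := s x • X.re x
  im x := s x • X.im x

lemma CVec.comp_scale (s : M → ℝ) (X : CVec M) (p : M) (i : Fin 4) (y : E4) :
    (X.scale s).comp p i y = s ((extChartAt (𝓡 4) p).symm y) * X.comp p i y := by
  have h : ∀ Y : (x : M) → TangentSpace (𝓡 4) x, chartVec p (fun x => s x • Y x) y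
      = s ((extChartAt (𝓡 4) p).symm y) • chartVec p Y y := fun Y => map_smul _ _ _
  simp only [CVec.comp, CVec.scale, h, PiLp.smul_apply, smul_eq_mul]
  push_cast
  ring

lemma frameMat_scale (s : M → ℝ) (e : Fin 4 → CVec M) (p : M) (y : E4) :
    frameMat (fun a => (e a).scale s) p y
      = (s ((extChartAt (𝓡 4) p).symm y) : ℂ) • frameMat e p y := by
  ext i a
  simp [frameMat, CVec.comp_scale]

variable [IsManifold (𝓡 4) ∞ M]

/-- A null tetrad for `g = s² g'` can be rescaled to a null tetrad for `g'`. -/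
lemma IsNullTetrad.conformal {o : ManifoldOrientation M} {g g' : RMetric M} {U : Set M}
    {ε : Fin 4 → CForm M} {e : Fin 4 → CVec M} (h : IsNullTetrad o g U ε e) {s : M → ℝ}
    (hs : ContMDiff (𝓡 4) 𝓘(ℝ, ℝ) ∞ s) (hs' : ContMDiff (𝓡 4) 𝓘(ℝ, ℝ) ∞ fun x => (s x)⁻¹)
    (hpos : ∀ x, 0 < s x)
    (hg : ∀ x (v w : TangentSpace (𝓡 4) x), g.inner x v w = s x ^ 2 * g'.inner x v w) :
    IsNullTetrad o g' U (fun a x => (s x)⁻¹ • ε a x) (fun a => (e a).scale s) where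
  smooth_form a := hs'.contMDiffOn.smul_section (h.smooth_form a)
  smooth_vec a := ⟨hs.contMDiffOn.smul_section (h.smooth_vec a).1,
    hs.contMDiffOn.smul_section (h.smooth_vec a).2⟩
  metric_eq x hx v w := by
    have h1 := h.metric_eq x hx v w
    have h2 : (s x : ℂ) ≠ 0 := Complex.ofReal_ne_zero.mpr (hpos x).ne'
    rw [hg] at h1
    push_cast at h1
    simp only [smul_apply, Complex.real_smul]
    push_cast
    field_simp
    linear_combination h1
  volume_eq x hx b hb := by
    obtain ⟨b', hb', hbb⟩ := hb.scale (g' := g) (inv_pos.mpr (hpos x)) fun v w => by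
      rw [inv_inv, hg]
    rw [← h.volume_eq x hx b' hb']
    congr 1
    ext i j
    simp [hbb]
  dual x hx i j := by
    have h2 : (s x : ℂ) ≠ 0 := Complex.ofReal_ne_zero.mpr (hpos x).ne'
    rw [← h.dual x hx i j]
    simp only [pair, CVec.scale, smul_apply, map_smul, Complex.real_smul]
    push_cast
    field_simp

/-- The coefficients `A⁰, A¹, A²` of the 1-form `A`, determined by the Levi-Civita connection of
the metric with null tetrad `ε, e` through `⟨A, X⟩ = -g(∇_X V, W)` for `V = e₃ + λ e₁` and
`W = e₀ - λ e₂`. -/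
def twistorForm (ε : Fin 4 → CForm M) (e : Fin 4 → CVec M) (k : Fin 3) : CForm M :=
  fun x => ∑ a, twistorCoeff (bracketCoeff ε e x) k a • ε a x

namespace IsNullTetrad

variable {o : ManifoldOrientation M} {g : RMetric M} {U : Set M} {ε : Fin 4 → CForm M}
  {e : Fin 4 → CVec M}

lemma twistorForm_coordVec (h : IsNullTetrad o g U ε e) (hU : IsOpen U) {p : M} {y : E4}
    (hy : y ∈ (extChartAt (𝓡 4) p).target) (hyU : (extChartAt (𝓡 4) p).symm y ∈ U) (k : Fin 3)
    (i : Fin 4) :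
    twistorForm ε e k ((extChartAt (𝓡 4) p).symm y) (coordVec p y i)
      = ∑ a, twistorCoeff (structFun (frameMat e p) (coframeMat ε p) y) k a
        * coframeMat ε p y a i := by
  rw [twistorForm, h.bracketCoeff_eq hU hy hyU, sum_apply]
  rfl

lemma contDiffAt_bracketCoeff (h : IsNullTetrad o g U ε e) (hU : IsOpen U) {p : M} (hp : p ∈ U)
    (a b c : Fin 4) :
    ContDiffAt ℝ ∞ (fun y => bracketCoeff ε e ((extChartAt (𝓡 4) p).symm y) a b c)
      (extChartAt (𝓡 4) p p) := by
  refine (contDiffAt_structFun (h.smoothMat_frameMat hU hp) (h.smoothMat_coframeMat hU hp)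
    a b c).congr_of_eventuallyEq ?_
  filter_upwards [eventually_mem_chart hU hp] with y hy
  rw [h.bracketCoeff_eq hU hy.1 hy.2]

lemma smoothOn_bracketCoeff (h : IsNullTetrad o g U ε e) (hU : IsOpen U) (a b c : Fin 4) :
    ContMDiffOn (𝓡 4) 𝓘(ℝ, ℂ) ∞ (fun x => bracketCoeff ε e x a b c) U :=
  contMDiffOn_of_chart fun _ hp => h.contDiffAt_bracketCoeff hU hp a b c

lemma smoothOn_twistorForm (h : IsNullTetrad o g U ε e) (hU : IsOpen U) (k : Fin 3) :
    (twistorForm ε e k).SmoothOn U := by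
  intro p hp
  refine ((contMDiffAt_form_iff _ p).mpr fun i => ?_).contMDiffWithinAt
  have h1 : ContDiffAt ℝ ∞ (fun y => ∑ a, twistorCoeff (structFun (frameMat e p)
      (coframeMat ε p) y) k a * coframeMat ε p y a i) (extChartAt (𝓡 4) p p) :=
    ContDiffAt.sum fun a _ => (contDiffAt_twistorCoeff (contDiffAt_structFun
      (h.smoothMat_frameMat hU hp) (h.smoothMat_coframeMat hU hp)) k a).mul
        (h.smoothMat_coframeMat hU hp a i)
  refine h1.congr_of_eventuallyEq ?_
  filter_upwards [eventually_mem_chart hU hp] with y hy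
  exact h.twistorForm_coordVec hU hy.1 hy.2 k i

end IsNullTetrad

/-- The functions `α` (for `c = 3`) and `β` (for `c = 0`): the components of
`[e₃ + λ e₁, e₀ - λ e₂]` along `e_c`, where `λ` is held constant in the Lie bracket. -/
def laxCoeff (ε : Fin 4 → CForm M) (e : Fin 4 → CVec M) (c : Fin 4) (k : Fin 3) (x : M) : ℂ :=
  ![bracketCoeff ε e x 3 0 c, bracketCoeff ε e x 1 0 c - bracketCoeff ε e x 3 2 c,
    -bracketCoeff ε e x 1 2 c] k

/-- The Lax relation for a null tetrad `ε, e`, where `A` is obtained from a null tetrad of a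
conformal metric with `W⁺ = 0`. The coefficients `α, β` are those of the given tetrad. -/
lemma lax_relation {o : ManifoldOrientation M} {g g' : RMetric M} {U : Set M}
    {ε : Fin 4 → CForm M} {e : Fin 4 → CVec M} {s : M → ℝ} (hU : IsOpen U)
    (h : IsNullTetrad o g U ε e)
    (h' : IsNullTetrad o g' U (fun a x => (s x)⁻¹ • ε a x) (fun a => (e a).scale s))
    (hs : ContMDiff (𝓡 4) 𝓘(ℝ, ℝ) ∞ fun x => (s x)⁻¹) (hpos : ∀ x, 0 < s x)
    (hWeyl : WeylPlusVanishes o g') {p : M} (hp : p ∈ U) (z : ℂ) {f : M × ℂ → ℂ}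
    (hf : ContMDiffAt ((𝓡 4).prod 𝓘(ℝ, ℂ)) 𝓘(ℝ, ℂ) ∞ f (p, z)) :
    let A := twistorForm (fun a x => (s x)⁻¹ • ε a x) (fun a => (e a).scale s)
    lax₁ e A (lax₂ e A f) (p, z) - lax₂ e A (lax₁ e A f) (p, z)
      = quadFun (laxCoeff ε e 3) (p, z) * lax₁ e A f (p, z)
        + quadFun (laxCoeff ε e 0) (p, z) * lax₂ e A f (p, z) := by
  intro A
  have hy := mem_extChartAt_target (I := 𝓡 4) p
  have hx := extChartAt_to_inv (I := 𝓡 4) p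
  have hev := eventually_mem_chart hU hp
  set y₀ := extChartAt (𝓡 4) p p with hy₀
  have hF : ContDiffAt ℝ ∞ (inChart p f) (y₀, z) := contDiffAt_inChart hy (by rwa [hx])
  have hnf := (h'.isNullFrame hU hp).1
  set V : Fin 4 → E4 × ℂ → ℂ := fun i q => vecV (frameMat e p q.1) q.2 i with hV
  set W : Fin 4 → E4 × ℂ → ℂ := fun i q => vecW (frameMat e p q.1) q.2 i with hW
  set B : Fin 4 → E4 × ℂ → ℂ := formComp A p with hB
  -- the two operators in the chart
  have hFev : ∀ᶠ q in 𝓝 (y₀, z), q.1 ∈ (extChartAt (𝓡 4) p).target ∧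
      DifferentiableAt ℝ (inChart p f) q := by
    refine (continuousAt_fst.eventually (hev.mono fun _ h => h.1)).and ?_
    exact ((hF.of_le (m := 1) (by simp)).eventually (by simp)).mono
      fun q hq => hq.differentiableAt (by simp)
  have hL1 : inChart p (lax₁ e A f) =ᶠ[𝓝 (y₀, z)] liftOp V B (inChart p f) :=
    hFev.mono fun q hq => lax₁_eq hq.1 hq.2 e A
  have hL2 : inChart p (lax₂ e A f) =ᶠ[𝓝 (y₀, z)] liftOp W B (inChart p f) :=
    hFev.mono fun q hq => lax₂_eq hq.1 hq.2 e A
  have hfst : ∀ {u : E4 → ℂ}, DifferentiableAt ℝ u y₀ →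
      DifferentiableAt ℝ (fun q : E4 × ℂ => u q.1) (y₀, z) := fun hu =>
    DifferentiableAt.comp (f := Prod.fst) (y₀, z) hu differentiableAt_fst
  have hsnd : DifferentiableAt ℝ (fun q : E4 × ℂ => q.2) (y₀, z) := differentiableAt_snd
  have hEd := (h.smoothMat_frameMat hU hp).differentiableAt
  have hVd : ∀ i, DifferentiableAt ℝ (V i) (y₀, z) := fun i =>
    (hfst (hEd i 3)).fun_add (hsnd.fun_mul (hfst (hEd i 1)))
  have hWd : ∀ i, DifferentiableAt ℝ (W i) (y₀, z) := fun i =>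
    (hfst (hEd i 0)).fun_add (hsnd.fun_mul (hfst (hEd i 2)).fun_neg)
  have hAd : ∀ i k, DifferentiableAt ℝ
      (fun y => A k ((extChartAt (𝓡 4) p).symm y) (coordVec p y i)) y₀ := fun i k =>
    ((contMDiffAt_form_iff (A k) p).mp ((h'.smoothOn_twistorForm hU k).contMDiffAt
      (hU.mem_nhds hp)) i).differentiableAt (by simp)
  have hBd : ∀ i, DifferentiableAt ℝ (B i) (y₀, z) := fun i =>
    ((hfst (hAd i 0)).fun_add (hsnd.fun_mul (hfst (hAd i 1)))).fun_add
      ((hsnd.fun_pow 2).fun_mul (hfst (hAd i 2)))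
  have hd1 := (differentiableAt_liftOp hVd hBd hF).congr_of_eventuallyEq hL1
  have hd2 := (differentiableAt_liftOp hWd hBd hF).congr_of_eventuallyEq hL2
  have e1 := lax₁_eq hy hd2 e A
  have e2 := lax₂_eq hy hd1 e A
  rw [liftOp_congr hL2] at e1
  rw [liftOp_congr hL1] at e2
  have e3 := hL1.self_of_nhds
  have e4 := hL2.self_of_nhds
  simp only [inChart] at e3 e4
  rw [hx] at e1 e2 e3 e4
  rw [e1, e2, e3, e4]
  -- the commutator
  have hyU : (extChartAt (𝓡 4) p).symm y₀ ∈ U := by rwa [hx]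
  have hs' : DifferentiableAt ℝ (fun y => (((s ((extChartAt (𝓡 4) p).symm y))⁻¹ : ℝ) : ℂ)) y₀ := by
    have h2 : ContMDiffAt 𝓘(ℝ, E4) (𝓡 4) ∞ (extChartAt (𝓡 4) p).symm y₀ :=
      (contMDiffOn_extChartAt_symm p).contMDiffAt (extChartAt_target_nhds hy)
    exact Complex.ofRealCLM.differentiableAt.comp y₀
      ((hs.contMDiffAt.comp y₀ h2).contDiffAt.differentiableAt (by simp))
  have hA : ∀ᶠ y in 𝓝 y₀, ∀ i k, A k ((extChartAt (𝓡 4) p).symm y) (coordVec p y i)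
      = connCoeff (frameConn (conn g' p) (frameMat (fun a => (e a).scale s) p)
        (coframeMat (fun a x => (s x)⁻¹ • ε a x) p) i y) k := by
    filter_upwards [hev, hnf.sum_twistorCoeff] with y h1 h2 i k
    rw [← h2 i k, ← h'.twistorForm_coordVec hU h1.1 h1.2 k i]
  have key := hnf.lax_commutator z (h'.sum_curvM hWeyl hU hp z) hs'
    (E := frameMat e p) (Θ := coframeMat ε p) (Filter.Eventually.of_forall fun y => by
      rw [frameMat_scale, smul_smul, ← Complex.ofReal_mul, inv_mul_cancel₀ (hpos _).ne',
        Complex.ofReal_one, one_smul])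
    (h.coframeMat_mul_frameMat hy hyU) hA hF
  have hC := h.bracketCoeff_eq hU hy hyU
  rw [hx] at hC
  have hcoeff : ∀ c, quadFun (laxCoeff ε e c) (p, z)
      = quadVal ![structFun (frameMat e p) (coframeMat ε p) y₀ 3 0 c,
        structFun (frameMat e p) (coframeMat ε p) y₀ 1 0 c
          - structFun (frameMat e p) (coframeMat ε p) y₀ 3 2 c,
        -structFun (frameMat e p) (coframeMat ε p) y₀ 1 2 c] z := fun c => by
    rw [← hC]
    rfl
  rw [hcoeff, hcoeff]
  exact key

end

end AntiSelfDual

end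

open AntiSelfDual

/-! ### The Lax pair -/

theorem theorem2 {M : Type*} [TopologicalSpace M] [ChartedSpace E4 M] [IsManifold (𝓡 4) ∞ M]
    (o : ManifoldOrientation M) (c : ConformalStructure M) (hc : c.IsAntiSelfDual o)
    (g : RMetric M) (hg : g ∈ c.reps)
    (U : Set M) (hU : IsOpen U)
    (ε : Fin 4 → CForm M) (e : Fin 4 → CVec M) (hε : IsNullTetrad o g U ε e) :
    ∃ (A : Fin 3 → CForm M) (α β : Fin 3 → M → ℂ),
      (∀ k, (A k).SmoothOn U) ∧
      (∀ k, ContMDiffOn (𝓡 4) 𝓘(ℝ, ℂ) ∞ (α k) U) ∧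
      (∀ k, ContMDiffOn (𝓡 4) 𝓘(ℝ, ℂ) ∞ (β k) U) ∧
      ∀ x ∈ U, ∀ z : ℂ, ∀ f : M × ℂ → ℂ,
        ContMDiffAt ((𝓡 4).prod 𝓘(ℝ, ℂ)) 𝓘(ℝ, ℂ) ∞ f (x, z) →
          lax₁ e A (lax₂ e A f) (x, z) - lax₂ e A (lax₁ e A f) (x, z) =
            quadFun α (x, z) * lax₁ e A f (x, z) + quadFun β (x, z) * lax₂ e A f (x, z) := by
  obtain ⟨g', hg', hW⟩ := hc
  obtain ⟨ρ, hρ, hpos, hgg⟩ := (c.mem_iff g' hg' g).mp hg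
  -- the metric with `W⁺ = 0` is `g' = ρ⁻¹ g`, so the tetrad is rescaled by `s = √ρ`
  have hs : ContMDiff (𝓡 4) 𝓘(ℝ, ℝ) ∞ fun x => √(ρ x) := fun x =>
    (Real.contDiffAt_sqrt (hpos x).ne').contMDiffAt.comp x (hρ x)
  have hspos : ∀ x, 0 < √(ρ x) := fun x => Real.sqrt_pos.mpr (hpos x)
  have hs' : ContMDiff (𝓡 4) 𝓘(ℝ, ℝ) ∞ fun x => (√(ρ x))⁻¹ := fun x =>
    (contDiffAt_inv ℝ (hspos x).ne').contMDiffAt.comp x (hs x)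
  have hε' := hε.conformal (g' := g') hs hs' hspos fun x v w => by
    rw [hgg, Real.sq_sqrt (hpos x).le]
  have hC := hε.smoothOn_bracketCoeff hU
  have hα : ∀ c k, ContMDiffOn (𝓡 4) 𝓘(ℝ, ℂ) ∞ (laxCoeff ε e c k) U := by
    intro c k
    fin_cases k
    · exact hC 3 0 c
    · exact (hC 1 0 c).sub (hC 3 2 c)
    · exact (hC 1 2 c).neg
  exact ⟨_, laxCoeff ε e 3, laxCoeff ε e 0, hε'.smoothOn_twistorForm hU, hα 3, hα 0,
    fun x hx z f hf => lax_relation hU hε hε' hs' hspos hW hx z hf⟩
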